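/- Let $\mathbb{C}$ be a category with \emph{local products}, i.e. with pullbacks of split epimorphisms along split epimorphisms (a canonical choice being fixed). A \emph{local product} is a diagram $A \underset{p_1}{\overset{e_1}{\rightleftarrows}} E \underset{e_2}{\overset{p_2}{\rightleftarrows}} C$ for which there are $f\colon A\to B$, $r\colon B\to A$, $g\colon C\to B$, $s\colon B\to C$ with $fr=1_B=gs$ such that $(E,p_1,p_2)$ is the pullback of $g$ along $f$, $e_1=\langle 1_A,sf\rangle$ and $e_2=\langle rg,1_C\rangle$. It is a \emph{local coproduct} if $(e_1,e_2)$ is moreover the pushout of $(r,s)$. All spans $(D,d,c)$, $d\colon D\to D_0$, $c\colon D\to D_1$, are spans for which the kernel pairs $D(d)$, $D(c)$ of $d$ and $c$ exist. Let $\mathcal{M}_0$ be the class of all of them, $\mathcal{M}_1$ the class of those with $(d,c)$ jointly monic, and $\mathcal{M}_2$ the class of those with $(d,c)$ jointly strongly monic, that is, orthogonal to all jointly epimorphic pairs: for every jointly epimorphic pair $e_i\colon X_i\to Y$ $(i=1,2)$ and all $f_i\colon X_i\to D$, $g_0\colon Y\to D_0$, $g_1\colon Y\to D_1$ with $df_i=g_0e_i$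 and $cf_i=g_1e_i$ there is a unique $m\colon Y\to D$ with $me_i=f_i$, $dm=g_0$, $cm=g_1$ (in the presence of binary products and equalizers: $\langle d,c\rangle$ is a strong monomorphism). For a class $\mathcal{M}$ of spans consider the following categories; the morphisms are the evident ones, preserving all of the structure. \begin{itemize} \item $\mathbf{Span}(\mathbb{C},\mathcal{M})$: the spans in $\mathcal{M}$. \item $\mathbf{RG}(\mathbb{C},\mathcal{M})$: the reflexive graphs $(C_1,C_0,d,e,c)$, $de=1_{C_0}=ce$, with $(C_1,d,c)\in\mathcal{M}$. \item $\mathbf{UMG}(\mathbb{C},\mathcal{M})$: such reflexive graphs with a multiplication $m\colon C_2\to C_1$ on the pullback $C_2$ of $c$ along $d$ (with projections $\pi_1,\pi_2$, $d\pi_1=c\pi_2$) such that $dm=d\pi_2$, $cm=c\pi_1$, $m\langle 1,ed\rangle=1=m\langle ec,1\rangle$. \item $\mathbf{Cat}(\mathbb{C},\mathcal{M})$, $\mathbf{Grpd}(\mathbb{C},\mathcal{M})$: the full subcategories of those with $m$ associative, respectively with $m$ associative and with inverses. \item $\mathbf{PreGrpd}(\mathbb{C},\mathcal{M})$: the spans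 in $\mathcal{M}$ with a morphism $p\colon D(d,c)\to D$ from the object $D(d,c)=D(d)\times_D D(c)$ of triples $(x,y,z)$ with $dx=dy$, $cy=cz$, such that $p(x,y,y)=x$, $p(y,y,z)=z$, $dp(x,y,z)=dz$, $cp(x,y,z)=cx$. \item $\mathbf{DiKite}(\mathbb{C},\mathcal{M})$: the directed kites, i.e. data $f,r,g,s$ as above, a span $(D,d,c)\in\mathcal{M}$ and $\alpha\colon A\to D$, $\beta\colon B\to D$, $\gamma\colon C\to D$ with $\alpha r=\beta=\gamma s$, $d\alpha=d\beta f$, $c\gamma=c\beta g$. \item $\mathbf{MKite}(\mathbb{C},\mathcal{M})$: the directed kites with a morphism $m\colon A\times_BC\to D$ such that $dm=d\gamma\pi_2$, $cm=c\alpha\pi_1$, $me_1=\alpha$, $me_2=\gamma$. \end{itemize} Write $\mathbf{RG}(\mathbb{C})$, $\mathbf{Grpd}(\mathbb{C})$ when no class is imposed. Let $U(\mathcal{M})$ be the following list of eleven conditions. (i)--(x): each of the five forgetful functors $\mathbf{Grpd}(\mathbb{C},\mathcal{M})\to\mathbf{RG}(\mathbb{C},\mathcal{M})$, $\mathbf{Cat}(\mathbb{C},\mathcal{M})\to\mathbf{RG}(\mathbb{C},\mathcal{M})$,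 $\mathbf{UMG}(\mathbb{C},\mathcal{M})\to\mathbf{RG}(\mathbb{C},\mathcal{M})$, $\mathbf{PreGrpd}(\mathbb{C},\mathcal{M})\to\mathbf{Span}(\mathbb{C},\mathcal{M})$, $\mathbf{MKite}(\mathbb{C},\mathcal{M})\to\mathbf{DiKite}(\mathbb{C},\mathcal{M})$ is an isomorphism of categories (five conditions), respectively has a section (five conditions). (xi): for all spans $(E,p_1\colon E\to A,p_2\colon E\to C)$ and $(D,d,c)$ in $\mathcal{M}$ with $(p_1,p_2)$ jointly monic and all $e_1\colon A\to E$, $e_2\colon C\to E$, $\alpha\colon A\to D$, $\beta\colon E\to D$, $\gamma\colon C\to D$ with $p_1e_1=1_A$, $p_2e_2=1_C$, $e_1p_1e_2p_2=e_2p_2e_1p_1$, $\alpha p_1e_2p_2=\beta=\gamma p_2e_1p_1$, $d\alpha p_1=d\alpha p_1e_2p_2$, $c\gamma p_2=c\gamma p_2e_1p_1$, there is a unique $m\colon E\to D$ with $me_1=\alpha$, $me_2=\gamma$, $dm=d\gamma p_2$, $cm=c\alpha p_1$. Then: \begin{enumerate} \item Let $\mathbb{C}$ be called of naturally Mal'tsev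 type if the Lawvere condition holds: the forgetful functor $\mathbf{Grpd}(\mathbb{C})\to\mathbf{RG}(\mathbb{C})$ is an isomorphism. This condition and the eleven conditions $U(\mathcal{M}_0)$ are all equivalent. If $\mathbb{C}$ has binary products and a terminal object, they are equivalent to the existence of a canonical Mal'tsev operation on every object: a family $p_D\colon D\times D\times D\to D$, natural in $D$, with $p_D\langle x,y,y\rangle=x$ and $p_D\langle x,x,y\rangle=y$ for all $x,y\colon Z\to D$. If pushouts of split monomorphisms along split monomorphisms exist, they are equivalent to every local product being a local coproduct. \item Let $\mathbb{C}$ be called of Mal'tsev type if every reflexive relation (reflexive graph with $(d,c)$ jointly monic) is symmetric, i.e. there is $i\colon C_1\to C_1$ with $di=c$, $ci=d$. This condition and the eleven conditions $U(\mathcal{M}_1)$ are all equivalent, and they are equivalent to every local product being extremal: for every local product as above, every $(D,d,c)\in\mathcal{M}_1$ and all $\alpha\colon A\to D$, $\gamma\colon C\to D$ with $d\alpha=d\gamma p_2e_1$ and $c\gamma=c\alpha p_1e_2$ there is a unique $m\colon E\to D$ with $dm=d\gamma p_2$, $cm=c\alpha p_1$, $me_1=\alpha$, $me_2=\gamma$.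 \item Assume that $\mathbb{C}$ has equalizers and that every composite $pk$ of an equalizer $k$ followed by a split epimorphism $p$ has a kernel pair. Let $\mathbb{C}$ be called of weakly Mal'tsev type if in every local product the pair $(e_1,e_2)$ is jointly epimorphic. This condition and the eleven conditions $U(\mathcal{M}_2)$ are all equivalent. \end{enumerate} -/

import Mathlib

open CategoryTheory CategoryTheory.Limits

universe v u v₁ u₁ v₂ u₂

noncomputable section

namespace MaltsevType

/-! ### Joint monicity, joint epicity, joint strong monicity -/

section Pairs

variable {𝒞 : Type u} [Category.{v} 𝒞]

/-- The pair `(d, c)` is jointly monic. -/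
def JointlyMonic {D D₀ D₁ : 𝒞} (d : D ⟶ D₀) (c : D ⟶ D₁) : Prop :=
  ∀ ⦃Z : 𝒞⦄ (x y : Z ⟶ D), x ≫ d = y ≫ d → x ≫ c = y ≫ c → x = y

/-- The pair `(e₁, e₂)` is jointly epic. -/
def JointlyEpic {A C E : 𝒞} (e₁ : A ⟶ E) (e₂ : C ⟶ E) : Prop :=
  ∀ ⦃Z : 𝒞⦄ (x y : E ⟶ Z), e₁ ≫ x = e₁ ≫ y → e₂ ≫ x = e₂ ≫ y → x = y

/-- The pair `(d, c)` is jointly strongly monic: it is orthogonal to all jointly epic pairs.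
Testing against the jointly epic pair `(𝟙, 𝟙)` shows that such a pair is jointly monic.
If the category has binary products and equalizers, then this says that
`⟨d, c⟩ : D ⟶ D₀ ⨯ D₁` is a strong monomorphism. -/
def JointlyStronglyMonic {D D₀ D₁ : 𝒞} (d : D ⟶ D₀) (c : D ⟶ D₁) : Prop :=
  ∀ ⦃X₁ X₂ Y : 𝒞⦄ (e₁ : X₁ ⟶ Y) (e₂ : X₂ ⟶ Y), JointlyEpic e₁ e₂ →
    ∀ (f₁ : X₁ ⟶ D) (f₂ : X₂ ⟶ D) (g₀ : Y ⟶ D₀) (g₁ : Y ⟶ D₁),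
      f₁ ≫ d = e₁ ≫ g₀ → f₁ ≫ c = e₁ ≫ g₁ → f₂ ≫ d = e₂ ≫ g₀ → f₂ ≫ c = e₂ ≫ g₁ →
      ∃! m : Y ⟶ D, e₁ ≫ m = f₁ ∧ e₂ ≫ m = f₂ ∧ m ≫ d = g₀ ∧ m ≫ c = g₁

end Pairs

/-! ### Local products -/

/-- `𝒞` has local products: pullbacks of split epimorphisms along split epimorphisms exist.
The canonical choice of such a pullback is `pullback f g`. -/
class HasLocalProducts (𝒞 : Type u) [Category.{v} 𝒞] : Prop where
  hasPullback {A B C : 𝒞} (f : A ⟶ B) (g : C ⟶ B) [IsSplitEpi f] [IsSplitEpi g] : HasPullback f g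

instance hasPullback_of_isSplitEpi {𝒞 : Type u} [Category.{v} 𝒞] [HasLocalProducts 𝒞]
    {A B C : 𝒞} (f : A ⟶ B) (g : C ⟶ B) [IsSplitEpi f] [IsSplitEpi g] : HasPullback f g :=
  HasLocalProducts.hasPullback f g

/-- A split square over `f, r, g, s` whose underlying square is a pullback, with
`e₁ = ⟨1, s f⟩` and `e₂ = ⟨r g, 1⟩` the induced morphisms into the pullback. -/
structure IsLocalProductSquare {𝒞 : Type u} [Category.{v} 𝒞] {A B C E : 𝒞}
    (f : A ⟶ B) (r : B ⟶ A) (g : C ⟶ B) (s : B ⟶ C)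
    (p₁ : E ⟶ A) (e₁ : A ⟶ E) (p₂ : E ⟶ C) (e₂ : C ⟶ E) : Prop where
  r_f : r ≫ f = 𝟙 B
  s_g : s ≫ g = 𝟙 B
  isPullback : IsPullback p₁ p₂ f g
  e₁_p₁ : e₁ ≫ p₁ = 𝟙 A
  e₁_p₂ : e₁ ≫ p₂ = f ≫ s
  e₂_p₁ : e₂ ≫ p₁ = g ≫ r
  e₂_p₂ : e₂ ≫ p₂ = 𝟙 C

/-- The diagram `A ⇄ E ⇄ C` given by `p₁, e₁, p₂, e₂` is a local product. -/
def IsLocalProduct {𝒞 : Type u} [Category.{v} 𝒞] {A C E : 𝒞}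
    (p₁ : E ⟶ A) (e₁ : A ⟶ E) (p₂ : E ⟶ C) (e₂ : C ⟶ E) : Prop :=
  ∃ (B : 𝒞) (f : A ⟶ B) (r : B ⟶ A) (g : C ⟶ B) (s : B ⟶ C),
    IsLocalProductSquare f r g s p₁ e₁ p₂ e₂

/-! ### Internal reflexive graphs -/

/-- An internal reflexive graph `(C₁, C₀, d, e, c)`. -/
structure RG (𝒞 : Type u) [Category.{v} 𝒞] where
  {C₁ : 𝒞}
  {C₀ : 𝒞}
  d : C₁ ⟶ C₀
  e : C₀ ⟶ C₁
  c : C₁ ⟶ C₀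
  e_d : e ≫ d = 𝟙 C₀
  e_c : e ≫ c = 𝟙 C₀

namespace RG

variable {𝒞 : Type u} [Category.{v} 𝒞]

instance (X : RG 𝒞) : IsSplitEpi X.d := ⟨⟨⟨X.e, X.e_d⟩⟩⟩

instance (X : RG 𝒞) : IsSplitEpi X.c := ⟨⟨⟨X.e, X.e_c⟩⟩⟩

/-- Morphisms of reflexive graphs. -/
@[ext]
structure Hom (X Y : RG 𝒞) where
  f₁ : X.C₁ ⟶ Y.C₁
  f₀ : X.C₀ ⟶ Y.C₀
  d_comm : f₁ ≫ Y.d = X.d ≫ f₀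
  c_comm : f₁ ≫ Y.c = X.c ≫ f₀
  e_comm : X.e ≫ f₁ = f₀ ≫ Y.e

instance : Category (RG 𝒞) where
  Hom := Hom
  id X := ⟨𝟙 _, 𝟙 _, by simp, by simp, by simp⟩
  comp φ ψ := ⟨φ.f₁ ≫ ψ.f₁, φ.f₀ ≫ ψ.f₀,
    by rw [Category.assoc, ψ.d_comm, ← Category.assoc, φ.d_comm, Category.assoc],
    by rw [Category.assoc, ψ.c_comm, ← Category.assoc, φ.c_comm, Category.assoc],
    by rw [← Category.assoc, φ.e_comm, Category.assoc, ψ.e_comm, Category.assoc]⟩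
  id_comp _ := Hom.ext (Category.id_comp _) (Category.id_comp _)
  comp_id _ := Hom.ext (Category.comp_id _) (Category.comp_id _)
  assoc _ _ _ := Hom.ext (Category.assoc _ _ _) (Category.assoc _ _ _)

variable [HasLocalProducts 𝒞]

/-- The object of composable pairs: the pullback of `c` along `d`. -/
abbrev C₂ (X : RG 𝒞) : 𝒞 := pullback X.d X.c

abbrev π₁ (X : RG 𝒞) : X.C₂ ⟶ X.C₁ := pullback.fst X.d X.c

abbrev π₂ (X : RG 𝒞) : X.C₂ ⟶ X.C₁ := pullback.snd X.d X.c

/-- `e₁ = ⟨1, e d⟩`. -/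
def e₁ (X : RG 𝒞) : X.C₁ ⟶ X.C₂ :=
  pullback.lift (𝟙 _) (X.d ≫ X.e) (by simp [X.e_c])

/-- `e₂ = ⟨e c, 1⟩`. -/
def e₂ (X : RG 𝒞) : X.C₁ ⟶ X.C₂ :=
  pullback.lift (X.c ≫ X.e) (𝟙 _) (by simp [X.e_d])

/-- The induced morphism `f₂ = f₁ ×_{f₀} f₁`. -/
def Hom.f₂ {X Y : RG 𝒞} (φ : Hom X Y) : X.C₂ ⟶ Y.C₂ :=
  pullback.map X.d X.c Y.d Y.c φ.f₁ φ.f₁ φ.f₀ φ.d_comm.symm φ.c_comm.symm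

end RG

/-! ### Unital multiplicative graphs, internal categories, internal groupoids -/

/-- An internal unital multiplicative graph. -/
structure UMG (𝒞 : Type u) [Category.{v} 𝒞] [HasLocalProducts 𝒞] where
  graph : RG 𝒞
  m : graph.C₂ ⟶ graph.C₁
  m_d : m ≫ graph.d = graph.π₂ ≫ graph.d
  m_c : m ≫ graph.c = graph.π₁ ≫ graph.c
  e₁_m : graph.e₁ ≫ m = 𝟙 graph.C₁
  e₂_m : graph.e₂ ≫ m = 𝟙 graph.C₁

namespace UMG

variable {𝒞 : Type u} [Category.{v} 𝒞] [HasLocalProducts 𝒞]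

/-- Morphisms of unital multiplicative graphs: the morphisms of reflexive graphs which preserve
the multiplication (`f₂` is compatible with `e₁` and `e₂` automatically). -/
@[ext]
structure Hom (X Y : UMG 𝒞) where
  toHom : X.graph ⟶ Y.graph
  m_comm : X.m ≫ RG.Hom.f₁ toHom = RG.Hom.f₂ toHom ≫ Y.m

instance : Category (UMG 𝒞) where
  Hom := Hom
  id X := ⟨𝟙 X.graph, by
    have h : RG.Hom.f₂ (𝟙 X.graph) = 𝟙 _ := pullback.map_id
    rw [h, Category.id_comp]
    exact Category.comp_id _⟩
  comp {X Y Z} φ ψ := ⟨φ.toHom ≫ ψ.toHom, by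
    have h : RG.Hom.f₂ (φ.toHom ≫ ψ.toHom) = RG.Hom.f₂ φ.toHom ≫ RG.Hom.f₂ ψ.toHom :=
      (pullback.map_comp _ _ _ _ _ _ φ.toHom.d_comm.symm φ.toHom.c_comm.symm
        ψ.toHom.d_comm.symm ψ.toHom.c_comm.symm).symm
    rw [h, Category.assoc, ← ψ.m_comm, ← Category.assoc, ← φ.m_comm, Category.assoc]
    rfl⟩
  id_comp _ := Hom.ext (Category.id_comp _)
  comp_id _ := Hom.ext (Category.comp_id _)
  assoc _ _ _ := Hom.ext (Category.assoc _ _ _)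

/-- The forgetful functor from unital multiplicative graphs to reflexive graphs. -/
def forget (𝒞 : Type u) [Category.{v} 𝒞] [HasLocalProducts 𝒞] : UMG 𝒞 ⥤ RG 𝒞 where
  obj X := X.graph
  map φ := φ.toHom

/-- The product `x y = m⟨x, y⟩` of two composable generalized elements. -/
def mul (X : UMG 𝒞) {Z : 𝒞} (x y : Z ⟶ X.graph.C₁)
    (h : x ≫ X.graph.d = y ≫ X.graph.c) : Z ⟶ X.graph.C₁ :=
  pullback.lift x y h ≫ X.m

lemma mul_d (X : UMG 𝒞) {Z : 𝒞} (x y : Z ⟶ X.graph.C₁) (h : x ≫ X.graph.d = y ≫ X.graph.c) :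
    X.mul x y h ≫ X.graph.d = y ≫ X.graph.d := by
  rw [mul, Category.assoc, X.m_d, pullback.lift_snd_assoc]

lemma mul_c (X : UMG 𝒞) {Z : 𝒞} (x y : Z ⟶ X.graph.C₁) (h : x ≫ X.graph.d = y ≫ X.graph.c) :
    X.mul x y h ≫ X.graph.c = x ≫ X.graph.c := by
  rw [mul, Category.assoc, X.m_c, pullback.lift_fst_assoc]

/-- Associativity `(x y) z = x (y z)`, for all generalized elements. -/
def IsAssociative (X : UMG 𝒞) : Prop :=
  ∀ ⦃Z : 𝒞⦄ (x y z : Z ⟶ X.graph.C₁) (hxy : x ≫ X.graph.d = y ≫ X.graph.c)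
    (hyz : y ≫ X.graph.d = z ≫ X.graph.c),
    X.mul (X.mul x y hxy) z ((X.mul_d x y hxy).trans hyz) =
      X.mul x (X.mul y z hyz) (hxy.trans (X.mul_c y z hyz).symm)

/-- Existence of inverses: `i : C₁ ⟶ C₁` with `x i(x) = 1` and `i(x) x = 1`. -/
def HasInverses (X : UMG 𝒞) : Prop :=
  ∃ (i : X.graph.C₁ ⟶ X.graph.C₁) (hd : i ≫ X.graph.d = X.graph.c)
    (hc : i ≫ X.graph.c = X.graph.d),
    X.mul (𝟙 _) i ((Category.id_comp _).trans hc.symm) = X.graph.c ≫ X.graph.e ∧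
    X.mul i (𝟙 _) (hd.trans (Category.id_comp _).symm) = X.graph.d ≫ X.graph.e

end UMG

section CatGrpd

variable (𝒞 : Type u) [Category.{v} 𝒞] [HasLocalProducts 𝒞]

/-- Internal categories, as a full subcategory of the unital multiplicative graphs. -/
def isInternalCat : ObjectProperty (UMG 𝒞) := fun X => X.IsAssociative

/-- Internal groupoids, as a full subcategory of the unital multiplicative graphs
(inverses are unique, and preserved by all internal functors). -/
def isInternalGrpd : ObjectProperty (UMG 𝒞) := fun X => X.IsAssociative ∧ X.HasInverses

abbrev InternalCat := (isInternalCat 𝒞).FullSubcategory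

abbrev InternalGrpd := (isInternalGrpd 𝒞).FullSubcategory

/-- The forgetful functor from internal categories to reflexive graphs. -/
def InternalCat.forget : InternalCat 𝒞 ⥤ RG 𝒞 := (isInternalCat 𝒞).ι ⋙ UMG.forget 𝒞

/-- The forgetful functor from internal groupoids to reflexive graphs. -/
def InternalGrpd.forget : InternalGrpd 𝒞 ⥤ RG 𝒞 := (isInternalGrpd 𝒞).ι ⋙ UMG.forget 𝒞

end CatGrpd

/-! ### Spans and the kernel pair construction -/

/-- A span `(D, d, c)` whose legs have kernel pairs. -/
structure Span (𝒞 : Type u) [Category.{v} 𝒞] where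
  {D : 𝒞}
  {D₀ : 𝒞}
  {D₁ : 𝒞}
  d : D ⟶ D₀
  c : D ⟶ D₁
  [hasKernelPair_d : HasPullback d d]
  [hasKernelPair_c : HasPullback c c]

attribute [instance] Span.hasKernelPair_d Span.hasKernelPair_c

namespace Span

variable {𝒞 : Type u} [Category.{v} 𝒞]

/-- Morphisms of spans. -/
@[ext]
structure Hom (S T : Span 𝒞) where
  h : S.D ⟶ T.D
  h₀ : S.D₀ ⟶ T.D₀
  h₁ : S.D₁ ⟶ T.D₁
  d_comm : h ≫ T.d = S.d ≫ h₀
  c_comm : h ≫ T.c = S.c ≫ h₁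

instance : Category (Span 𝒞) where
  Hom := Hom
  id S := ⟨𝟙 _, 𝟙 _, 𝟙 _, by simp, by simp⟩
  comp φ ψ := ⟨φ.h ≫ ψ.h, φ.h₀ ≫ ψ.h₀, φ.h₁ ≫ ψ.h₁,
    by rw [Category.assoc, ψ.d_comm, ← Category.assoc, φ.d_comm, Category.assoc],
    by rw [Category.assoc, ψ.c_comm, ← Category.assoc, φ.c_comm, Category.assoc]⟩
  id_comp _ := Hom.ext (Category.id_comp _) (Category.id_comp _) (Category.id_comp _)
  comp_id _ := Hom.ext (Category.comp_id _) (Category.comp_id _) (Category.comp_id _)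
  assoc _ _ _ := Hom.ext (Category.assoc _ _ _) (Category.assoc _ _ _) (Category.assoc _ _ _)

/-- The kernel pair `D(d)` of `d`, with projections `d₁, d₂`. -/
abbrev Kd (S : Span 𝒞) : 𝒞 := pullback S.d S.d

abbrev d₁ (S : Span 𝒞) : S.Kd ⟶ S.D := pullback.fst S.d S.d

abbrev d₂ (S : Span 𝒞) : S.Kd ⟶ S.D := pullback.snd S.d S.d

/-- The kernel pair `D(c)` of `c`, with projections `c₁, c₂`. -/
abbrev Kc (S : Span 𝒞) : 𝒞 := pullback S.c S.c

abbrev c₁ (S : Span 𝒞) : S.Kc ⟶ S.D := pullback.fst S.c S.c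

abbrev c₂ (S : Span 𝒞) : S.Kc ⟶ S.D := pullback.snd S.c S.c

variable [HasLocalProducts 𝒞]

/-- The object `D(d, c)` of triples `(x, y, z)` with `d x = d y` and `c y = c z`. -/
abbrev Kdc (S : Span 𝒞) : 𝒞 := pullback S.d₂ S.c₁

abbrev p₁ (S : Span 𝒞) : S.Kdc ⟶ S.Kd := pullback.fst S.d₂ S.c₁

abbrev p₂ (S : Span 𝒞) : S.Kdc ⟶ S.Kc := pullback.snd S.d₂ S.c₁

/-- `e₁(x, y) = (x, y, y)`. -/
def e₁ (S : Span 𝒞) : S.Kd ⟶ S.Kdc :=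
  pullback.lift (𝟙 _) (S.d₂ ≫ pullback.diagonal S.c) (by simp)

/-- `e₂(y, z) = (y, y, z)`. -/
def e₂ (S : Span 𝒞) : S.Kc ⟶ S.Kdc :=
  pullback.lift (S.c₁ ≫ pullback.diagonal S.d) (𝟙 _) (by simp)

/-- The morphism `h³ : D(d, c) ⟶ D'(d', c')` induced by a morphism of spans. -/
def Hom.cube {S T : Span 𝒞} (φ : Hom S T) : S.Kdc ⟶ T.Kdc :=
  pullback.map S.d₂ S.c₁ T.d₂ T.c₁
    (pullback.map S.d S.d T.d T.d φ.h φ.h φ.h₀ φ.d_comm.symm φ.d_comm.symm)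
    (pullback.map S.c S.c T.c T.c φ.h φ.h φ.h₁ φ.c_comm.symm φ.c_comm.symm)
    φ.h (pullback.lift_snd _ _ _).symm (pullback.lift_fst _ _ _).symm

end Span

/-- The span part of a reflexive graph. -/
def RG.span {𝒞 : Type u} [Category.{v} 𝒞] [HasLocalProducts 𝒞] (X : RG 𝒞) : Span 𝒞 where
  d := X.d
  c := X.c

/-! ### Pregroupoids -/

/-- A pregroupoid: a span with a pregroupoid structure `p : D(d, c) ⟶ D`. -/
structure PreGrpd (𝒞 : Type u) [Category.{v} 𝒞] [HasLocalProducts 𝒞] where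
  span : Span 𝒞
  p : span.Kdc ⟶ span.D
  e₁_p : span.e₁ ≫ p = span.d₁
  e₂_p : span.e₂ ≫ p = span.c₂
  p_d : p ≫ span.d = span.p₂ ≫ span.c₂ ≫ span.d
  p_c : p ≫ span.c = span.p₁ ≫ span.d₁ ≫ span.c

namespace PreGrpd

variable {𝒞 : Type u} [Category.{v} 𝒞] [HasLocalProducts 𝒞]

/-- Morphisms of pregroupoids: the morphisms of spans which preserve the structure `p`. -/
@[ext]
structure Hom (X Y : PreGrpd 𝒞) where
  toHom : X.span ⟶ Y.span
  p_comm : X.p ≫ Span.Hom.h toHom = Span.Hom.cube toHom ≫ Y.p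

instance : Category (PreGrpd 𝒞) where
  Hom := Hom
  id X := ⟨𝟙 X.span, by
    have h : Span.Hom.cube (𝟙 X.span) = 𝟙 _ := by
      apply pullback.hom_ext <;> apply pullback.hom_ext <;>
        simp [Span.Hom.cube, CategoryStruct.id]
    rw [h, Category.id_comp]
    exact Category.comp_id _⟩
  comp {X Y Z} φ ψ := ⟨φ.toHom ≫ ψ.toHom, by
    have h : Span.Hom.cube (φ.toHom ≫ ψ.toHom) =
        Span.Hom.cube φ.toHom ≫ Span.Hom.cube ψ.toHom := by
      apply pullback.hom_ext <;> apply pullback.hom_ext <;>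
        simp [Span.Hom.cube, CategoryStruct.comp, pullback.map, pullback.lift_fst_assoc,
          pullback.lift_snd_assoc, pullback.lift_fst, pullback.lift_snd]
    rw [h, Category.assoc, ← ψ.p_comm, ← Category.assoc, ← φ.p_comm, Category.assoc]
    rfl⟩
  id_comp _ := Hom.ext (Category.id_comp _)
  comp_id _ := Hom.ext (Category.comp_id _)
  assoc _ _ _ := Hom.ext (Category.assoc _ _ _)

/-- The forgetful functor from pregroupoids to spans. -/
def forget (𝒞 : Type u) [Category.{v} 𝒞] [HasLocalProducts 𝒞] : PreGrpd 𝒞 ⥤ Span 𝒞 where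
  obj X := X.span
  map φ := φ.toHom

end PreGrpd

/-! ### Directed kites -/

/-- A directed kite with direction the span `(D, d, c)`. -/
structure DiKite (𝒞 : Type u) [Category.{v} 𝒞] where
  span : Span 𝒞
  {A : 𝒞}
  {B : 𝒞}
  {C : 𝒞}
  f : A ⟶ B
  r : B ⟶ A
  g : C ⟶ B
  s : B ⟶ C
  α : A ⟶ span.D
  β : B ⟶ span.D
  γ : C ⟶ span.D
  r_f : r ≫ f = 𝟙 B
  s_g : s ≫ g = 𝟙 B
  r_α : r ≫ α = β
  s_γ : s ≫ γ = β
  α_d : α ≫ span.d = f ≫ β ≫ span.d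
  γ_c : γ ≫ span.c = g ≫ β ≫ span.c

namespace DiKite

variable {𝒞 : Type u} [Category.{v} 𝒞]

instance (K : DiKite 𝒞) : IsSplitEpi K.f := ⟨⟨⟨K.r, K.r_f⟩⟩⟩

instance (K : DiKite 𝒞) : IsSplitEpi K.g := ⟨⟨⟨K.s, K.s_g⟩⟩⟩

/-- Morphisms of directed kites: natural transformations between the diagrams. -/
@[ext]
structure Hom (K L : DiKite 𝒞) where
  hSpan : K.span ⟶ L.span
  hA : K.A ⟶ L.A
  hB : K.B ⟶ L.B
  hC : K.C ⟶ L.C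
  f_comm : K.f ≫ hB = hA ≫ L.f
  r_comm : K.r ≫ hA = hB ≫ L.r
  g_comm : K.g ≫ hB = hC ≫ L.g
  s_comm : K.s ≫ hC = hB ≫ L.s
  α_comm : K.α ≫ Span.Hom.h hSpan = hA ≫ L.α
  β_comm : K.β ≫ Span.Hom.h hSpan = hB ≫ L.β
  γ_comm : K.γ ≫ Span.Hom.h hSpan = hC ≫ L.γ

lemma paste {W X Y X' Y' Z' : 𝒞} {a : W ⟶ X} {b : X ⟶ Y} {k : W ⟶ X'}
    {l : X ⟶ Y'} {a' : X' ⟶ Y'} {b' : Y' ⟶ Z'} {n : Y ⟶ Z'}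
    (h : k ≫ a' = a ≫ l) (h' : l ≫ b' = b ≫ n) : k ≫ a' ≫ b' = (a ≫ b) ≫ n := by
  rw [← Category.assoc, h, Category.assoc, h', Category.assoc]

instance : Category (DiKite 𝒞) where
  Hom := Hom
  id K := ⟨𝟙 _, 𝟙 _, 𝟙 _, 𝟙 _, by simp, by simp, by simp, by simp,
    (Category.comp_id _).trans (Category.id_comp _).symm,
    (Category.comp_id _).trans (Category.id_comp _).symm,
    (Category.comp_id _).trans (Category.id_comp _).symm⟩
  comp φ ψ := ⟨φ.hSpan ≫ ψ.hSpan, φ.hA ≫ ψ.hA, φ.hB ≫ ψ.hB, φ.hC ≫ ψ.hC,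
    paste φ.f_comm ψ.f_comm, paste φ.r_comm ψ.r_comm, paste φ.g_comm ψ.g_comm,
    paste φ.s_comm ψ.s_comm, paste φ.α_comm ψ.α_comm, paste φ.β_comm ψ.β_comm,
    paste φ.γ_comm ψ.γ_comm⟩
  id_comp _ := Hom.ext (Category.id_comp _) (Category.id_comp _) (Category.id_comp _)
    (Category.id_comp _)
  comp_id _ := Hom.ext (Category.comp_id _) (Category.comp_id _) (Category.comp_id _)
    (Category.comp_id _)
  assoc _ _ _ := Hom.ext (Category.assoc _ _ _) (Category.assoc _ _ _) (Category.assoc _ _ _)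
    (Category.assoc _ _ _)

variable [HasLocalProducts 𝒞]

/-- The local product `A ×_B C` of a kite. -/
abbrev P (K : DiKite 𝒞) : 𝒞 := pullback K.f K.g

abbrev π₁ (K : DiKite 𝒞) : K.P ⟶ K.A := pullback.fst K.f K.g

abbrev π₂ (K : DiKite 𝒞) : K.P ⟶ K.C := pullback.snd K.f K.g

/-- `e₁ = ⟨1, s f⟩`. -/
def e₁ (K : DiKite 𝒞) : K.A ⟶ K.P :=
  pullback.lift (𝟙 _) (K.f ≫ K.s) (by simp [K.s_g])

/-- `e₂ = ⟨r g, 1⟩`. -/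
def e₂ (K : DiKite 𝒞) : K.C ⟶ K.P :=
  pullback.lift (K.g ≫ K.r) (𝟙 _) (by simp [K.r_f])

/-- The induced morphism `h_A ×_{h_B} h_C`. -/
def Hom.prod {K L : DiKite 𝒞} (φ : Hom K L) : K.P ⟶ L.P :=
  pullback.map K.f K.g L.f L.g φ.hA φ.hC φ.hB φ.f_comm φ.g_comm

end DiKite

/-- A multiplicative directed kite. -/
structure MKite (𝒞 : Type u) [Category.{v} 𝒞] [HasLocalProducts 𝒞] where
  kite : DiKite 𝒞
  m : kite.P ⟶ kite.span.D
  m_d : m ≫ kite.span.d = kite.π₂ ≫ kite.γ ≫ kite.span.d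
  m_c : m ≫ kite.span.c = kite.π₁ ≫ kite.α ≫ kite.span.c
  e₁_m : kite.e₁ ≫ m = kite.α
  e₂_m : kite.e₂ ≫ m = kite.γ

namespace MKite

variable {𝒞 : Type u} [Category.{v} 𝒞] [HasLocalProducts 𝒞]

/-- Morphisms of multiplicative directed kites: the morphisms of directed kites which preserve
the multiplication. -/
@[ext]
structure Hom (X Y : MKite 𝒞) where
  toHom : X.kite ⟶ Y.kite
  m_comm : X.m ≫ Span.Hom.h (DiKite.Hom.hSpan toHom) = DiKite.Hom.prod toHom ≫ Y.m

instance : Category (MKite 𝒞) where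
  Hom := Hom
  id X := ⟨𝟙 X.kite, by
    have h : DiKite.Hom.prod (𝟙 X.kite) = 𝟙 _ := pullback.map_id
    rw [h, Category.id_comp]
    exact Category.comp_id _⟩
  comp {X Y Z} φ ψ := ⟨φ.toHom ≫ ψ.toHom, by
    have h : DiKite.Hom.prod (φ.toHom ≫ ψ.toHom) =
        DiKite.Hom.prod φ.toHom ≫ DiKite.Hom.prod ψ.toHom :=
      (pullback.map_comp _ _ _ _ _ _ φ.toHom.f_comm φ.toHom.g_comm
        ψ.toHom.f_comm ψ.toHom.g_comm).symm
    rw [h, Category.assoc, ← ψ.m_comm, ← Category.assoc, ← φ.m_comm, Category.assoc]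
    rfl⟩
  id_comp _ := Hom.ext (Category.id_comp _)
  comp_id _ := Hom.ext (Category.comp_id _)
  assoc _ _ _ := Hom.ext (Category.assoc _ _ _)

/-- The forgetful functor from multiplicative directed kites to directed kites. -/
def forget (𝒞 : Type u) [Category.{v} 𝒞] [HasLocalProducts 𝒞] : MKite 𝒞 ⥤ DiKite 𝒞 where
  obj X := X.kite
  map φ := φ.toHom

end MKite

/-! ### The conditions of the Unification Theorem for a class of spans -/

section Functors

variable {𝒳 : Type u₁} [Category.{v₁} 𝒳] {𝒴 : Type u₂} [Category.{v₂} 𝒴]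

/-- `F` is an isomorphism of categories. -/
def IsIsoOfCategories (F : 𝒳 ⥤ 𝒴) : Prop :=
  ∃ G : 𝒴 ⥤ 𝒳, F ⋙ G = 𝟭 𝒳 ∧ G ⋙ F = 𝟭 𝒴

/-- `F` has a section. -/
def HasSection (F : 𝒳 ⥤ 𝒴) : Prop :=
  ∃ G : 𝒴 ⥤ 𝒳, G ⋙ F = 𝟭 𝒴

/-- The restriction of `F` to the full subcategory given by `P` and its preimage. -/
def restrict (F : 𝒳 ⥤ 𝒴) (P : ObjectProperty 𝒴) :
    (P.inverseImage F).FullSubcategory ⥤ P.FullSubcategory :=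
  P.lift ((P.inverseImage F).ι ⋙ F) (fun X => X.property)

end Functors

section Conditions

variable {𝒞 : Type u} [Category.{v} 𝒞]

/-- The Kite Condition relative to `M`. -/
def KiteCondition (M : ObjectProperty (Span 𝒞)) : Prop :=
  ∀ (E S : Span 𝒞), M E → M S → JointlyMonic E.d E.c →
    ∀ (e₁ : E.D₀ ⟶ E.D) (e₂ : E.D₁ ⟶ E.D) (α : E.D₀ ⟶ S.D) (β : E.D ⟶ S.D) (γ : E.D₁ ⟶ S.D),
      e₁ ≫ E.d = 𝟙 _ → e₂ ≫ E.c = 𝟙 _ →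
      (E.c ≫ e₂) ≫ (E.d ≫ e₁) = (E.d ≫ e₁) ≫ (E.c ≫ e₂) →
      (E.c ≫ e₂ ≫ E.d) ≫ α = β → (E.d ≫ e₁ ≫ E.c) ≫ γ = β →
      E.d ≫ α ≫ S.d = (E.c ≫ e₂ ≫ E.d) ≫ α ≫ S.d →
      E.c ≫ γ ≫ S.c = (E.d ≫ e₁ ≫ E.c) ≫ γ ≫ S.c →
      ∃! m : E.D ⟶ S.D, e₁ ≫ m = α ∧ e₂ ≫ m = γ ∧
        m ≫ S.d = E.c ≫ γ ≫ S.d ∧ m ≫ S.c = E.d ≫ α ≫ S.c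

variable [HasLocalProducts 𝒞]

/-- The reflexive graphs whose span part is in `M`. -/
def graphsIn (M : ObjectProperty (Span 𝒞)) : ObjectProperty (RG 𝒞) := fun X => M X.span

/-- The directed kites whose direction is in `M`. -/
def kitesIn (M : ObjectProperty (Span 𝒞)) : ObjectProperty (DiKite 𝒞) := fun K => M K.span

/-- The eleven conditions of the Unification Theorem, for the class of spans `M`. -/
def unificationConditions (M : ObjectProperty (Span 𝒞)) : List Prop :=
  [IsIsoOfCategories (restrict (InternalGrpd.forget 𝒞) (graphsIn M)),
   HasSection (restrict (InternalGrpd.forget 𝒞) (graphsIn M)),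
   IsIsoOfCategories (restrict (InternalCat.forget 𝒞) (graphsIn M)),
   HasSection (restrict (InternalCat.forget 𝒞) (graphsIn M)),
   IsIsoOfCategories (restrict (UMG.forget 𝒞) (graphsIn M)),
   HasSection (restrict (UMG.forget 𝒞) (graphsIn M)),
   IsIsoOfCategories (restrict (PreGrpd.forget 𝒞) M),
   HasSection (restrict (PreGrpd.forget 𝒞) M),
   IsIsoOfCategories (restrict (MKite.forget 𝒞) (kitesIn M)),
   HasSection (restrict (MKite.forget 𝒞) (kitesIn M)),
   KiteCondition M]

end Conditions

/-! ### The three classes of spans and the three notions -/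

section Notions

variable (𝒞 : Type u) [Category.{v} 𝒞]

/-- All spans whose legs have kernel pairs. -/
def M₀ : ObjectProperty (Span 𝒞) := fun _ => True

/-- The jointly monic spans whose legs have kernel pairs. -/
def M₁ : ObjectProperty (Span 𝒞) := fun S => JointlyMonic S.d S.c

/-- The jointly strongly monic spans whose legs have kernel pairs. -/
def M₂ : ObjectProperty (Span 𝒞) := fun S => JointlyStronglyMonic S.d S.c

/-- Naturally Mal'tsev type, i.e. the Lawvere condition: the forgetful functor from internal
groupoids to reflexive graphs is an isomorphism. -/
def IsNaturallyMaltsev [HasLocalProducts 𝒞] : Prop :=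
  IsIsoOfCategories (InternalGrpd.forget 𝒞)

/-- Mal'tsev type: every reflexive relation is symmetric. -/
def IsMaltsev : Prop :=
  ∀ X : RG 𝒞, JointlyMonic X.d X.c → ∃ i : X.C₁ ⟶ X.C₁, i ≫ X.d = X.c ∧ i ≫ X.c = X.d

/-- Weakly Mal'tsev type: in every local product, the pair `(e₁, e₂)` is jointly epic. -/
def IsWeaklyMaltsev : Prop :=
  ∀ ⦃A C E : 𝒞⦄ (p₁ : E ⟶ A) (e₁ : A ⟶ E) (p₂ : E ⟶ C) (e₂ : C ⟶ E),
    IsLocalProduct p₁ e₁ p₂ e₂ → JointlyEpic e₁ e₂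

/-- Every local product is a local coproduct. -/
def LocalProductsAreLocalCoproducts : Prop :=
  ∀ ⦃A B C E : 𝒞⦄ (f : A ⟶ B) (r : B ⟶ A) (g : C ⟶ B) (s : B ⟶ C)
    (p₁ : E ⟶ A) (e₁ : A ⟶ E) (p₂ : E ⟶ C) (e₂ : C ⟶ E),
    IsLocalProductSquare f r g s p₁ e₁ p₂ e₂ → IsPushout r s e₁ e₂

/-- The local product given by `p₁, e₁, p₂, e₂` is extremal. -/
def IsExtremal {𝒞 : Type u} [Category.{v} 𝒞] {A C E : 𝒞}
    (p₁ : E ⟶ A) (e₁ : A ⟶ E) (p₂ : E ⟶ C) (e₂ : C ⟶ E) : Prop :=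
  ∀ S : Span 𝒞, M₁ 𝒞 S → ∀ (α : A ⟶ S.D) (γ : C ⟶ S.D),
    α ≫ S.d = e₁ ≫ p₂ ≫ γ ≫ S.d → γ ≫ S.c = e₂ ≫ p₁ ≫ α ≫ S.c →
    ∃! m : E ⟶ S.D, m ≫ S.d = p₂ ≫ γ ≫ S.d ∧ m ≫ S.c = p₁ ≫ α ≫ S.c ∧
      e₁ ≫ m = α ∧ e₂ ≫ m = γ

/-- Every local product is extremal. -/
def LocalProductsAreExtremal : Prop :=
  ∀ ⦃A C E : 𝒞⦄ (p₁ : E ⟶ A) (e₁ : A ⟶ E) (p₂ : E ⟶ C) (e₂ : C ⟶ E),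
    IsLocalProduct p₁ e₁ p₂ e₂ → IsExtremal p₁ e₁ p₂ e₂

/-- Every object `D` admits a Mal'tsev operation `D × D × D ⟶ D`, naturally in `D`. -/
def HasNaturalMaltsevOperation [HasBinaryProducts 𝒞] : Prop :=
  ∃ p : ∀ D : 𝒞, D ⨯ (D ⨯ D) ⟶ D,
    (∀ ⦃D D' : 𝒞⦄ (h : D ⟶ D'), prod.map h (prod.map h h) ≫ p D' = p D ≫ h) ∧
    ∀ ⦃Z D : 𝒞⦄ (x y : Z ⟶ D),
      prod.lift x (prod.lift y y) ≫ p D = x ∧ prod.lift x (prod.lift x y) ≫ p D = y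

/-- Pushouts of split monomorphisms along split monomorphisms exist. -/
def HasPushoutsOfSplitMonos : Prop :=
  ∀ ⦃A B C : 𝒞⦄ (r : B ⟶ A) (s : B ⟶ C), IsSplitMono r → IsSplitMono s → HasPushout r s

/-- Every composite of a split epimorphism with an equalizer has a kernel pair. -/
def HasKernelPairsOfEqualizerSplitEpi [HasEqualizers 𝒞] : Prop :=
  ∀ ⦃E Z A : 𝒞⦄ (u v : E ⟶ Z) (p : E ⟶ A), IsSplitEpi p →
    HasPullback (equalizer.ι u v ≫ p) (equalizer.ι u v ≫ p)

end Notions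

end MaltsevType

end

/-!
Reflexive graphs, spans and local products all give rise to directed kites, so that unital
multiplications, pregroupoid structures and liftings along local products are all multiplications
of kites. Everything is compared with one condition, `HasUniqueKiteMul M`: every directed kite with
direction in `M` has a unique multiplication.

Uniqueness makes multiplications natural, and it forces associativity of the pregroupoid structures
`p`, hence `p (x, 1, y)` is the multiplication of a groupoid; so all forgetful functors are
isomorphisms. Conversely, a section of any of them yields pregroupoid structures that are natural
with respect to morphisms of spans: for reflexive graphs, `p (x, y, z)` is read off the product of
the arrows `(z, z, y)` and `(y, x, x)` in the graph whose arrows from `z` to `x` are the triples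
`(x, y, z)`. A natural `p` in turn multiplies a kite by `p (α p₁, β, γ p₂)`. This multiplication is
unique, because the pregroupoid structure of the span `(p₂, p₁)` writes the identity of a local
product as `p (e₁ p₁, e₂ p₂ e₁ p₁, e₂ p₂)` and every multiplication preserves `p`.

The graph of a jointly (strongly) monic span is again jointly (strongly) monic, so the argument
stays within each class. A natural Mal'tsev operation is a natural `p` on the spans `1 ← D → 1`,
and the symmetry of the relation `∃ y, d x = d y ∧ c y = c z` sends `(x, y, z)` to
`(z, p (x, y, z), x)`. Finally, applied to the two split epimorphisms to `A` and `C` from a pushout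
of `(r, s)`, or from an equalizer of two morphisms which agree on `e₁` and `e₂`, a kite
multiplication is a section of the canonical morphism to the local product.
-/

universe v₃ u₃ v₄ u₄

noncomputable section

namespace MaltsevType

/-! ### Isomorphisms of categories and sections -/

section Functors

variable {𝒳 : Type u₁} [Category.{v₁} 𝒳] {𝒴 : Type u₂} [Category.{v₂} 𝒴]

lemma IsIsoOfCategories.hasSection {F : 𝒳 ⥤ 𝒴} (h : IsIsoOfCategories F) : HasSection F := by
  obtain ⟨G, -, hG⟩ := h
  exact ⟨G, hG⟩

lemma isIsoOfCategories_of_obj_bijective (F : 𝒳 ⥤ 𝒴) [F.Full] [F.Faithful]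
    (h : Function.Bijective F.obj) : IsIsoOfCategories F := by
  choose o ho using h.2
  let G : 𝒴 ⥤ 𝒳 :=
    { obj := o
      map := fun {y y'} φ => F.preimage (eqToHom (ho y) ≫ φ ≫ eqToHom (ho y').symm)
      map_id := fun y => F.map_injective (by simp)
      map_comp := fun φ ψ => F.map_injective (by simp) }
  refine ⟨G, CategoryTheory.Functor.ext (fun x => h.1 (ho _)) fun x x' φ => ?_,
    CategoryTheory.Functor.ext ho fun y y' φ => ?_⟩
  · apply F.map_injective
    simp [G, eqToHom_map]
  · simp [G]

lemma isIsoOfCategories_restrict (F : 𝒳 ⥤ 𝒴) [F.Faithful] (P : ObjectProperty 𝒴)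
    (surj : ∀ y, P y → ∃ x, F.obj x = y)
    (inj : ∀ x x', P (F.obj x) → F.obj x = F.obj x' → x = x')
    (full : ∀ x x', P (F.obj x) → P (F.obj x') → ∀ φ : F.obj x ⟶ F.obj x', ∃ ψ, F.map ψ = φ) :
    IsIsoOfCategories (restrict F P) := by
  have : (restrict F P).Faithful := ⟨fun h =>
    ObjectProperty.hom_ext _ (F.map_injective (congrArg P.ι.map h))⟩
  have : (restrict F P).Full := ⟨fun {x x'} φ => by
    obtain ⟨ψ, hψ⟩ := full x.obj x'.obj x.property x'.property φ.hom
    exact ⟨ObjectProperty.homMk ψ, ObjectProperty.hom_ext _ hψ⟩⟩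
  apply isIsoOfCategories_of_obj_bijective
  constructor
  · rintro ⟨x, hx⟩ ⟨x', hx'⟩ h
    obtain rfl := inj x x' hx (congrArg ObjectProperty.FullSubcategory.obj h)
    rfl
  · rintro ⟨y, hy⟩
    obtain ⟨x, rfl⟩ := surj y hy
    exact ⟨⟨x, hy⟩, rfl⟩

lemma isIsoOfCategories_restrict_iff (F : 𝒳 ⥤ 𝒴) {P : ObjectProperty 𝒴} (hP : ∀ y, P y) :
    IsIsoOfCategories (restrict F P) ↔ IsIsoOfCategories F := by
  let J : 𝒴 ⥤ P.FullSubcategory := P.lift (𝟭 𝒴) hP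
  let I : 𝒳 ⥤ (P.inverseImage F).FullSubcategory :=
    (P.inverseImage F).lift (𝟭 𝒳) (fun x => hP (F.obj x))
  constructor
  · rintro ⟨G, hFG, hGF⟩
    exact ⟨J ⋙ G ⋙ (P.inverseImage F).ι,
      congrArg (fun H => I ⋙ H ⋙ (P.inverseImage F).ι) hFG,
      congrArg (fun H => J ⋙ H ⋙ P.ι) hGF⟩
  · rintro ⟨G, hFG, hGF⟩
    exact ⟨P.ι ⋙ G ⋙ I,
      congrArg (fun H => (P.inverseImage F).ι ⋙ H ⋙ I) hFG,
      congrArg (fun H => P.ι ⋙ H ⋙ J) hGF⟩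

lemma HasSection.exists_lift {𝒵 : Type u₃} [Category.{v₃} 𝒵] {𝒲 : Type u₄} [Category.{v₄} 𝒲]
    {F : 𝒳 ⥤ 𝒴} {P : ObjectProperty 𝒴} (h : HasSection (restrict F P))
    {L : 𝒳 ⥤ 𝒵} {U : 𝒵 ⥤ 𝒲} {K : 𝒴 ⥤ 𝒲} (w : L ⋙ U = F ⋙ K) :
    ∃ G : P.FullSubcategory ⥤ 𝒵, G ⋙ U = P.ι ⋙ K := by
  obtain ⟨G, hG⟩ := h
  refine ⟨G ⋙ (P.inverseImage F).ι ⋙ L, ?_⟩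
  calc G ⋙ (P.inverseImage F).ι ⋙ L ⋙ U = G ⋙ (P.inverseImage F).ι ⋙ F ⋙ K := by rw [w]
    _ = (G ⋙ restrict F P) ⋙ P.ι ⋙ K := rfl
    _ = P.ι ⋙ K := by rw [hG]; rfl

end Functors

lemma tfae_of_forall_iff {q : Prop} {l : List Prop} (h : ∀ p ∈ l, (p ↔ q)) : l.TFAE :=
  fun _ ha _ hb => (h _ ha).trans (h _ hb).symm

section Faithful

variable (𝒞 : Type u) [Category.{v} 𝒞] [HasLocalProducts 𝒞]

instance : (UMG.forget 𝒞).Faithful := ⟨fun h => UMG.Hom.ext h⟩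

instance : (PreGrpd.forget 𝒞).Faithful := ⟨fun h => PreGrpd.Hom.ext h⟩

instance : (MKite.forget 𝒞).Faithful := ⟨fun h => MKite.Hom.ext h⟩

end Faithful

/-! ### Local products -/

section LocalProducts

variable {𝒞 : Type u} [Category.{v} 𝒞]

lemma jointlyStronglyMonic_of_exists {D D₀ D₁ : 𝒞} {d : D ⟶ D₀} {c : D ⟶ D₁}
    (h : ∀ ⦃X₁ X₂ Y : 𝒞⦄ (e₁ : X₁ ⟶ Y) (e₂ : X₂ ⟶ Y), JointlyEpic e₁ e₂ →
      ∀ (f₁ : X₁ ⟶ D) (f₂ : X₂ ⟶ D) (g₀ : Y ⟶ D₀) (g₁ : Y ⟶ D₁),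
        f₁ ≫ d = e₁ ≫ g₀ → f₁ ≫ c = e₁ ≫ g₁ → f₂ ≫ d = e₂ ≫ g₀ → f₂ ≫ c = e₂ ≫ g₁ →
        ∃ m : Y ⟶ D, e₁ ≫ m = f₁ ∧ e₂ ≫ m = f₂ ∧ m ≫ d = g₀ ∧ m ≫ c = g₁) :
    JointlyStronglyMonic d c := by
  intro X₁ X₂ Y e₁ e₂ he f₁ f₂ g₀ g₁ h₁ h₂ h₃ h₄
  obtain ⟨m, hm⟩ := h e₁ e₂ he f₁ f₂ g₀ g₁ h₁ h₂ h₃ h₄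
  exact ⟨m, hm, fun n hn => he _ _ (hn.1.trans hm.1.symm) (hn.2.1.trans hm.2.1.symm)⟩

lemma JointlyMonic.swap {D D₀ D₁ : 𝒞} {d : D ⟶ D₀} {c : D ⟶ D₁} (h : JointlyMonic d c) :
    JointlyMonic c d :=
  fun _ x y hc hd => h x y hd hc

lemma JointlyStronglyMonic.swap {D D₀ D₁ : 𝒞} {d : D ⟶ D₀} {c : D ⟶ D₁}
    (h : JointlyStronglyMonic d c) : JointlyStronglyMonic c d := by
  apply jointlyStronglyMonic_of_exists
  intro X₁ X₂ Y e₁ e₂ he f₁ f₂ g₀ g₁ h₁ h₂ h₃ h₄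
  obtain ⟨m, ⟨hm₁, hm₂, hmd, hmc⟩, -⟩ := h e₁ e₂ he f₁ f₂ g₁ g₀ h₂ h₁ h₄ h₃
  exact ⟨m, hm₁, hm₂, hmc, hmd⟩

lemma jointlyMonic_of_isPullback {A B C E : 𝒞} {p₁ : E ⟶ A} {p₂ : E ⟶ C} {f : A ⟶ B}
    {g : C ⟶ B} (h : IsPullback p₁ p₂ f g) : JointlyMonic p₁ p₂ :=
  fun _ _ _ => h.hom_ext

lemma jointlyStronglyMonic_of_isPullback {A B C E : 𝒞} {p₁ : E ⟶ A} {p₂ : E ⟶ C} {f : A ⟶ B}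
    {g : C ⟶ B} (h : IsPullback p₁ p₂ f g) : JointlyStronglyMonic p₁ p₂ := by
  apply jointlyStronglyMonic_of_exists
  intro X₁ X₂ Y e₁ e₂ he f₁ f₂ g₀ g₁ h₁ h₂ h₃ h₄
  have hg : g₀ ≫ f = g₁ ≫ g := by
    apply he
    · rw [← reassoc_of% h₁, ← reassoc_of% h₂, h.w]
    · rw [← reassoc_of% h₃, ← reassoc_of% h₄, h.w]
  exact ⟨h.lift g₀ g₁ hg, h.hom_ext (by simp [h₁]) (by simp [h₂]),
    h.hom_ext (by simp [h₃]) (by simp [h₄]), by simp, by simp⟩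

lemma isLocalProductSquare_pullback {A B C : 𝒞} {f : A ⟶ B} {r : B ⟶ A} {g : C ⟶ B} {s : B ⟶ C}
    [HasPullback f g] (hr : r ≫ f = 𝟙 B) (hs : s ≫ g = 𝟙 B)
    (h₁ : 𝟙 A ≫ f = (f ≫ s) ≫ g) (h₂ : (g ≫ r) ≫ f = 𝟙 C ≫ g) :
    IsLocalProductSquare f r g s (pullback.fst f g) (pullback.lift (𝟙 A) (f ≫ s) h₁)
      (pullback.snd f g) (pullback.lift (g ≫ r) (𝟙 C) h₂) where
  r_f := hr
  s_g := hs
  isPullback := IsPullback.of_hasPullback f g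
  e₁_p₁ := pullback.lift_fst _ _ _
  e₁_p₂ := pullback.lift_snd _ _ _
  e₂_p₁ := pullback.lift_fst _ _ _
  e₂_p₂ := pullback.lift_snd _ _ _

namespace IsLocalProductSquare

variable {A B C E : 𝒞} {f : A ⟶ B} {r : B ⟶ A} {g : C ⟶ B} {s : B ⟶ C}
  {p₁ : E ⟶ A} {e₁ : A ⟶ E} {p₂ : E ⟶ C} {e₂ : C ⟶ E}

lemma r_e₁ (H : IsLocalProductSquare f r g s p₁ e₁ p₂ e₂) : r ≫ e₁ = s ≫ e₂ := by
  apply H.isPullback.hom_ext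
  · simp [H.e₁_p₁, H.e₂_p₁, reassoc_of% H.s_g]
  · simp [H.e₁_p₂, H.e₂_p₂, reassoc_of% H.r_f]

/-- The span of the two projections of a local product. Their kernel pairs exist since the
projections are split epimorphisms. -/
def span [HasLocalProducts 𝒞] (H : IsLocalProductSquare f r g s p₁ e₁ p₂ e₂) : Span 𝒞 :=
  have : IsSplitEpi p₁ := ⟨⟨⟨e₁, H.e₁_p₁⟩⟩⟩
  have : IsSplitEpi p₂ := ⟨⟨⟨e₂, H.e₂_p₂⟩⟩⟩
  { d := p₁, c := p₂ }

end IsLocalProductSquare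

end LocalProducts

/-! ### Multiplications on kites -/

section KiteMul

variable {𝒞 : Type u} [Category.{v} 𝒞]

/-- `m : E ⟶ D` is a multiplication on the directed kite formed by a local product with
injections `e₁, e₂` and projections `p₁, p₂`, a span `S = (D, d, c)`, and `α, γ`. The
multiplications of unital multiplicative graphs, pregroupoids and multiplicative kites are all
of this kind. -/
structure IsKiteMul (S : Span 𝒞) {A C E : 𝒞} (p₁ : E ⟶ A) (e₁ : A ⟶ E) (p₂ : E ⟶ C) (e₂ : C ⟶ E)
    (α : A ⟶ S.D) (γ : C ⟶ S.D) (m : E ⟶ S.D) : Prop where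
  e₁_m : e₁ ≫ m = α
  e₂_m : e₂ ≫ m = γ
  m_d : m ≫ S.d = p₂ ≫ γ ≫ S.d
  m_c : m ≫ S.c = p₁ ≫ α ≫ S.c

namespace IsKiteMul

variable {S T : Span 𝒞} {A C E A' C' E' : 𝒞} {p₁ : E ⟶ A} {e₁ : A ⟶ E} {p₂ : E ⟶ C} {e₂ : C ⟶ E}
  {p₁' : E' ⟶ A'} {e₁' : A' ⟶ E'} {p₂' : E' ⟶ C'} {e₂' : C' ⟶ E'}
  {α : A ⟶ S.D} {γ : C ⟶ S.D} {m : E ⟶ S.D}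

lemma postcomp (hm : IsKiteMul S p₁ e₁ p₂ e₂ α γ m) (φ : S ⟶ T) :
    IsKiteMul T p₁ e₁ p₂ e₂ (α ≫ φ.h) (γ ≫ φ.h) (m ≫ φ.h) where
  e₁_m := by rw [reassoc_of% hm.e₁_m]
  e₂_m := by rw [reassoc_of% hm.e₂_m]
  m_d := by simp only [Category.assoc, φ.d_comm, reassoc_of% hm.m_d]
  m_c := by simp only [Category.assoc, φ.c_comm, reassoc_of% hm.m_c]

lemma precomp (hm : IsKiteMul S p₁ e₁ p₂ e₂ α γ m) {hA : A' ⟶ A} {hC : C' ⟶ C} {hE : E' ⟶ E}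
    (hp₁ : hE ≫ p₁ = p₁' ≫ hA) (he₁ : e₁' ≫ hE = hA ≫ e₁)
    (hp₂ : hE ≫ p₂ = p₂' ≫ hC) (he₂ : e₂' ≫ hE = hC ≫ e₂) :
    IsKiteMul S p₁' e₁' p₂' e₂' (hA ≫ α) (hC ≫ γ) (hE ≫ m) where
  e₁_m := by rw [reassoc_of% he₁, hm.e₁_m]
  e₂_m := by rw [reassoc_of% he₂, hm.e₂_m]
  m_d := by rw [Category.assoc, hm.m_d, reassoc_of% hp₂, Category.assoc]
  m_c := by rw [Category.assoc, hm.m_c, reassoc_of% hp₁, Category.assoc]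

end IsKiteMul

/-- Every directed kite whose direction is in `M` has a unique multiplication. The local product
is an arbitrary one, not only the chosen pullback. -/
def HasUniqueKiteMul (M : ObjectProperty (Span 𝒞)) : Prop :=
  ∀ ⦃A B C E : 𝒞⦄ ⦃f : A ⟶ B⦄ ⦃r : B ⟶ A⦄ ⦃g : C ⟶ B⦄ ⦃s : B ⟶ C⦄
    ⦃p₁ : E ⟶ A⦄ ⦃e₁ : A ⟶ E⦄ ⦃p₂ : E ⟶ C⦄ ⦃e₂ : C ⟶ E⦄,
    IsLocalProductSquare f r g s p₁ e₁ p₂ e₂ → ∀ S : Span 𝒞, M S →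
    ∀ (α : A ⟶ S.D) (γ : C ⟶ S.D), r ≫ α = s ≫ γ →
      α ≫ S.d = f ≫ r ≫ α ≫ S.d → γ ≫ S.c = g ≫ s ≫ γ ≫ S.c →
      ∃! m, IsKiteMul S p₁ e₁ p₂ e₂ α γ m

namespace HasUniqueKiteMul

variable {M : ObjectProperty (Span 𝒞)} {A B C E A' C' E' : 𝒞}
  {f : A ⟶ B} {r : B ⟶ A} {g : C ⟶ B} {s : B ⟶ C}
  {p₁ : E ⟶ A} {e₁ : A ⟶ E} {p₂ : E ⟶ C} {e₂ : C ⟶ E}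
  {p₁' : E' ⟶ A'} {e₁' : A' ⟶ E'} {p₂' : E' ⟶ C'} {e₂' : C' ⟶ E'}

lemma eq (h : HasUniqueKiteMul M) (H : IsLocalProductSquare f r g s p₁ e₁ p₂ e₂) {S : Span 𝒞}
    (hS : M S) {α : A ⟶ S.D} {γ : C ⟶ S.D} {m n : E ⟶ S.D}
    (hm : IsKiteMul S p₁ e₁ p₂ e₂ α γ m) (hn : IsKiteMul S p₁ e₁ p₂ e₂ α γ n) : m = n := by
  refine (h H S hS α γ ?_ ?_ ?_).unique hm hn
  · rw [← hm.e₁_m, ← hm.e₂_m, reassoc_of% H.r_e₁]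
  · rw [← hm.e₁_m, Category.assoc, hm.m_d, reassoc_of% H.e₁_p₂, reassoc_of% H.r_f]
  · rw [← hm.e₂_m, Category.assoc, hm.m_c, reassoc_of% H.e₂_p₁, reassoc_of% H.s_g]

lemma comp_h_eq (h : HasUniqueKiteMul M) (H : IsLocalProductSquare f r g s p₁ e₁ p₂ e₂)
    {S T : Span 𝒞} (hT : M T) (φ : S ⟶ T) {α : A ⟶ S.D} {γ : C ⟶ S.D} {m : E ⟶ S.D}
    (hm : IsKiteMul S p₁ e₁ p₂ e₂ α γ m) {α' : A' ⟶ T.D} {γ' : C' ⟶ T.D} {m' : E' ⟶ T.D}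
    (hm' : IsKiteMul T p₁' e₁' p₂' e₂' α' γ' m') {hA : A ⟶ A'} {hC : C ⟶ C'} {hE : E ⟶ E'}
    (hp₁ : hE ≫ p₁' = p₁ ≫ hA) (he₁ : e₁ ≫ hE = hA ≫ e₁')
    (hp₂ : hE ≫ p₂' = p₂ ≫ hC) (he₂ : e₂ ≫ hE = hC ≫ e₂')
    (hα : α ≫ φ.h = hA ≫ α') (hγ : γ ≫ φ.h = hC ≫ γ') :
    m ≫ φ.h = hE ≫ m' :=
  h.eq H hT (hα ▸ hγ ▸ hm.postcomp φ) (hm'.precomp hp₁ he₁ hp₂ he₂)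

end HasUniqueKiteMul

end KiteMul

namespace DiKite

variable {𝒞 : Type u} [Category.{v} 𝒞] [HasLocalProducts 𝒞]

lemma isLocalProductSquare (K : DiKite 𝒞) :
    IsLocalProductSquare K.f K.r K.g K.s K.π₁ K.e₁ K.π₂ K.e₂ :=
  isLocalProductSquare_pullback K.r_f K.s_g _ _

variable {K L : DiKite 𝒞} (φ : K ⟶ L)

lemma prod_π₁ : φ.prod ≫ L.π₁ = K.π₁ ≫ φ.hA :=
  pullback.lift_fst _ _ _

lemma prod_π₂ : φ.prod ≫ L.π₂ = K.π₂ ≫ φ.hC :=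
  pullback.lift_snd _ _ _

lemma e₁_prod : K.e₁ ≫ φ.prod = φ.hA ≫ L.e₁ := by
  apply L.isLocalProductSquare.isPullback.hom_ext
  · rw [Category.assoc, Category.assoc, prod_π₁, reassoc_of% K.isLocalProductSquare.e₁_p₁,
      L.isLocalProductSquare.e₁_p₁, Category.comp_id]
  · rw [Category.assoc, Category.assoc, prod_π₂, reassoc_of% K.isLocalProductSquare.e₁_p₂,
      L.isLocalProductSquare.e₁_p₂, φ.s_comm, reassoc_of% φ.f_comm]

lemma e₂_prod : K.e₂ ≫ φ.prod = φ.hC ≫ L.e₂ := by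
  apply L.isLocalProductSquare.isPullback.hom_ext
  · rw [Category.assoc, Category.assoc, prod_π₁, reassoc_of% K.isLocalProductSquare.e₂_p₁,
      L.isLocalProductSquare.e₂_p₁, φ.r_comm, reassoc_of% φ.g_comm]
  · rw [Category.assoc, Category.assoc, prod_π₂, reassoc_of% K.isLocalProductSquare.e₂_p₂,
      L.isLocalProductSquare.e₂_p₂, Category.comp_id]

end DiKite

section

variable {𝒞 : Type u} [Category.{v} 𝒞] [HasLocalProducts 𝒞]

/-- `m` is a multiplication on the directed kite `K`. -/
abbrev DiKite.IsMul (K : DiKite 𝒞) (m : K.P ⟶ K.span.D) : Prop :=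
  IsKiteMul K.span K.π₁ K.e₁ K.π₂ K.e₂ K.α K.γ m

lemma MKite.isMul (K : MKite 𝒞) : K.kite.IsMul K.m :=
  ⟨K.e₁_m, K.e₂_m, K.m_d, K.m_c⟩

lemma exists_natural_mul_of_lift {𝒲 : Type u₁} [Category.{v₁} 𝒲] {G : 𝒲 ⥤ MKite 𝒞}
    {H : 𝒲 ⥤ DiKite 𝒞} (hG : G ⋙ MKite.forget 𝒞 = H) :
    ∃ m : ∀ W, (H.obj W).P ⟶ (H.obj W).span.D, (∀ W, (H.obj W).IsMul (m W)) ∧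
      ∀ ⦃V W⦄ (φ : V ⟶ W), m V ≫ (H.map φ).hSpan.h = (H.map φ).prod ≫ m W := by
  subst hG
  exact ⟨fun W => (G.obj W).m, fun W => (G.obj W).isMul, fun V W φ => (G.map φ).m_comm⟩

namespace HasUniqueKiteMul

variable {M : ObjectProperty (Span 𝒞)}

lemma existsUnique_isMul (h : HasUniqueKiteMul M) (K : DiKite 𝒞) (hK : M K.span) :
    ∃! m, K.IsMul m :=
  h K.isLocalProductSquare K.span hK K.α K.γ (K.r_α.trans K.s_γ.symm)
    (by rw [reassoc_of% K.r_α, K.α_d]) (by rw [reassoc_of% K.s_γ, K.γ_c])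

lemma isMul_natural (h : HasUniqueKiteMul M) {K L : DiKite 𝒞} (hL : M L.span)
    {m : K.P ⟶ K.span.D} {n : L.P ⟶ L.span.D} (hm : K.IsMul m) (hn : L.IsMul n) (φ : K ⟶ L) :
    m ≫ φ.hSpan.h = φ.prod ≫ n :=
  h.comp_h_eq K.isLocalProductSquare hL φ.hSpan hm hn (DiKite.prod_π₁ φ) (DiKite.e₁_prod φ)
    (DiKite.prod_π₂ φ) (DiKite.e₂_prod φ) φ.α_comm φ.γ_comm

lemma isIsoOfCategories_mKite (h : HasUniqueKiteMul M) :
    IsIsoOfCategories (restrict (MKite.forget 𝒞) (kitesIn M)) := by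
  refine isIsoOfCategories_restrict _ _ (fun K hK => ?_) ?_ fun K L _ hL φ =>
    ⟨⟨φ, h.isMul_natural hL K.isMul L.isMul φ⟩, rfl⟩
  · obtain ⟨m, hm⟩ := (h.existsUnique_isMul K hK).exists
    exact ⟨⟨K, m, hm.m_d, hm.m_c, hm.e₁_m, hm.e₂_m⟩, rfl⟩
  · rintro ⟨K, m, hmd, hmc, hm₁, hm₂⟩ ⟨K', n, hnd, hnc, hn₁, hn₂⟩ hK (rfl : K = K')
    obtain rfl := (h.existsUnique_isMul K hK).unique ⟨hm₁, hm₂, hmd, hmc⟩ ⟨hn₁, hn₂, hnd, hnc⟩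
    rfl

end HasUniqueKiteMul

end

/-! ### Reflexive graphs and spans as kites -/

section

variable (𝒞 : Type u) [Category.{v} 𝒞] [HasLocalProducts 𝒞]

/-- The directed kite of a reflexive graph; its multiplications are the unital multiplications of
the graph. -/
def RG.toDiKite : RG 𝒞 ⥤ DiKite 𝒞 where
  obj X :=
    { span := X.span
      f := X.d
      r := X.e
      g := X.c
      s := X.e
      α := 𝟙 X.C₁
      β := X.e
      γ := 𝟙 X.C₁
      r_f := X.e_d
      s_g := X.e_c
      r_α := Category.comp_id _
      s_γ := Category.comp_id _
      α_d := by simp [RG.span, X.e_d]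
      γ_c := by simp [RG.span, X.e_c] }
  map φ :=
    { hSpan := ⟨φ.f₁, φ.f₀, φ.f₀, φ.d_comm, φ.c_comm⟩
      hA := φ.f₁
      hB := φ.f₀
      hC := φ.f₁
      f_comm := φ.d_comm.symm
      r_comm := φ.e_comm
      g_comm := φ.c_comm.symm
      s_comm := φ.e_comm
      α_comm := (Category.id_comp _).trans (Category.comp_id _).symm
      β_comm := φ.e_comm
      γ_comm := (Category.id_comp _).trans (Category.comp_id _).symm }

/-- The directed kite of a span; its multiplications are the pregroupoid structures of the
span. -/
def Span.toDiKite : Span 𝒞 ⥤ DiKite 𝒞 where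
  obj S :=
    { span := S
      f := S.d₂
      r := pullback.diagonal S.d
      g := S.c₁
      s := pullback.diagonal S.c
      α := S.d₁
      β := 𝟙 _
      γ := S.c₂
      r_f := pullback.diagonal_snd _
      s_g := pullback.diagonal_fst _
      r_α := pullback.diagonal_fst _
      s_γ := pullback.diagonal_snd _
      α_d := by rw [Category.id_comp, pullback.condition]
      γ_c := by rw [Category.id_comp, pullback.condition] }
  map {S T} φ :=
    { hSpan := φ
      hA := pullback.map S.d S.d T.d T.d φ.h φ.h φ.h₀ φ.d_comm.symm φ.d_comm.symm
      hB := φ.h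
      hC := pullback.map S.c S.c T.c T.c φ.h φ.h φ.h₁ φ.c_comm.symm φ.c_comm.symm
      f_comm := (pullback.lift_snd _ _ _).symm
      r_comm := by apply pullback.hom_ext <;>
        simp [pullback.map, pullback.lift_fst, pullback.lift_snd]
      g_comm := (pullback.lift_fst _ _ _).symm
      s_comm := by apply pullback.hom_ext <;>
        simp [pullback.map, pullback.lift_fst, pullback.lift_snd]
      α_comm := (pullback.lift_fst _ _ _).symm
      β_comm := (Category.id_comp _).trans (Category.comp_id _).symm
      γ_comm := (pullback.lift_snd _ _ _).symm }
  map_id _ := DiKite.Hom.ext rfl pullback.map_id rfl pullback.map_id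
  map_comp φ ψ := DiKite.Hom.ext rfl
    (pullback.map_comp _ _ _ _ _ _ φ.d_comm.symm φ.d_comm.symm ψ.d_comm.symm ψ.d_comm.symm).symm
    rfl
    (pullback.map_comp _ _ _ _ _ _ φ.c_comm.symm φ.c_comm.symm ψ.c_comm.symm ψ.c_comm.symm).symm

/-- A unital multiplicative graph as a multiplicative directed kite. -/
def UMG.toMKite : UMG 𝒞 ⥤ MKite 𝒞 where
  obj U :=
    { kite := (RG.toDiKite 𝒞).obj U.graph
      m := U.m
      m_d := U.m_d.trans (congrArg (U.graph.π₂ ≫ ·) (Category.id_comp _).symm)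
      m_c := U.m_c.trans (congrArg (U.graph.π₁ ≫ ·) (Category.id_comp _).symm)
      e₁_m := U.e₁_m
      e₂_m := U.e₂_m }
  map φ := ⟨(RG.toDiKite 𝒞).map φ.toHom, φ.m_comm⟩

/-- A pregroupoid as a multiplicative directed kite. -/
def PreGrpd.toMKite : PreGrpd 𝒞 ⥤ MKite 𝒞 where
  obj X :=
    { kite := (Span.toDiKite 𝒞).obj X.span
      m := X.p
      m_d := X.p_d
      m_c := X.p_c
      e₁_m := X.e₁_p
      e₂_m := X.e₂_p }
  map φ := ⟨(Span.toDiKite 𝒞).map φ.toHom, φ.p_comm⟩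
  map_id X := MKite.Hom.ext ((Span.toDiKite 𝒞).map_id X.span)
  map_comp φ ψ := MKite.Hom.ext ((Span.toDiKite 𝒞).map_comp φ.toHom ψ.toHom)

end

/-! ### Pregroupoids -/

namespace Span

variable {𝒞 : Type u} [Category.{v} 𝒞] [HasLocalProducts 𝒞] (S : Span 𝒞)

/-- `p : D(d, c) ⟶ D` is a pregroupoid structure on `S`. -/
abbrev IsPregroupoid (p : S.Kdc ⟶ S.D) : Prop :=
  IsKiteMul S S.p₁ S.e₁ S.p₂ S.e₂ S.d₁ S.c₂ p

/-- The generalized element `(x, y, z)` of `D(d, c)`. -/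
def triple {Z : 𝒞} (x y z : Z ⟶ S.D) (h : x ≫ S.d = y ≫ S.d) (h' : y ≫ S.c = z ≫ S.c) :
    Z ⟶ S.Kdc :=
  pullback.lift (pullback.lift x y h) (pullback.lift y z h')
    (by rw [pullback.lift_snd, pullback.lift_fst])

/-- The first component of a triple `(x, y, z)` in `D(d, c)`. -/
def fst : S.Kdc ⟶ S.D := S.p₁ ≫ S.d₁

/-- The middle component of a triple `(x, y, z)` in `D(d, c)`. -/
def mid : S.Kdc ⟶ S.D := S.p₁ ≫ S.d₂

/-- The last component of a triple `(x, y, z)` in `D(d, c)`. -/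
def lst : S.Kdc ⟶ S.D := S.p₂ ≫ S.c₂

lemma mid_eq : S.mid = S.p₂ ≫ S.c₁ := pullback.condition

lemma fst_d : S.fst ≫ S.d = S.mid ≫ S.d := by
  rw [fst, mid, Category.assoc, Category.assoc, pullback.condition (f := S.d)]

lemma mid_c : S.mid ≫ S.c = S.lst ≫ S.c := by
  rw [mid_eq, lst, Category.assoc, Category.assoc, pullback.condition (f := S.c)]

section

variable {Z : 𝒞} (x y z : Z ⟶ S.D) (h : x ≫ S.d = y ≫ S.d) (h' : y ≫ S.c = z ≫ S.c)

@[simp]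
lemma triple_fst : S.triple x y z h h' ≫ S.fst = x := by
  rw [triple, fst, pullback.lift_fst_assoc, pullback.lift_fst]

@[simp]
lemma triple_mid : S.triple x y z h h' ≫ S.mid = y := by
  rw [triple, mid, pullback.lift_fst_assoc, pullback.lift_snd]

@[simp]
lemma triple_lst : S.triple x y z h h' ≫ S.lst = z := by
  rw [triple, lst, pullback.lift_snd_assoc, pullback.lift_snd]

end

variable {S} in
lemma triple_hom_ext {Z : 𝒞} {t t' : Z ⟶ S.Kdc} (h₁ : t ≫ S.fst = t' ≫ S.fst)
    (h₂ : t ≫ S.mid = t' ≫ S.mid) (h₃ : t ≫ S.lst = t' ≫ S.lst) : t = t' := by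
  apply pullback.hom_ext <;> apply pullback.hom_ext
  · simpa only [Category.assoc, fst] using h₁
  · simpa only [Category.assoc, mid] using h₂
  · simpa only [Category.assoc, mid_eq] using h₂
  · simpa only [Category.assoc, lst] using h₃

lemma comp_triple {W Z : 𝒞} (w : W ⟶ Z) (x y z : Z ⟶ S.D) (h : x ≫ S.d = y ≫ S.d)
    (h' : y ≫ S.c = z ≫ S.c) :
    w ≫ S.triple x y z h h' = S.triple (w ≫ x) (w ≫ y) (w ≫ z) (by simp [h]) (by simp [h']) := by
  apply triple_hom_ext <;> simp

lemma triple_components : S.triple S.fst S.mid S.lst S.fst_d S.mid_c = 𝟙 _ := by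
  apply triple_hom_ext <;> simp

lemma lift_e₁ {Z : 𝒞} (x y : Z ⟶ S.D) (h : x ≫ S.d = y ≫ S.d) :
    pullback.lift x y h ≫ S.e₁ = S.triple x y y h rfl := by
  apply pullback.hom_ext <;> apply pullback.hom_ext <;>
    simp [e₁, triple, pullback.lift_fst, pullback.lift_snd]

lemma lift_e₂ {Z : 𝒞} (y z : Z ⟶ S.D) (h : y ≫ S.c = z ≫ S.c) :
    pullback.lift y z h ≫ S.e₂ = S.triple y y z rfl h := by
  apply pullback.hom_ext <;> apply pullback.hom_ext <;>
    simp [e₂, triple, pullback.lift_fst, pullback.lift_snd]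

section Cube

variable {S} {T : Span 𝒞} (φ : S ⟶ T)

lemma cube_fst : φ.cube ≫ T.fst = S.fst ≫ φ.h := by
  simp [Hom.cube, fst, pullback.map, pullback.lift_fst, pullback.lift_fst_assoc]

lemma cube_mid : φ.cube ≫ T.mid = S.mid ≫ φ.h := by
  simp [Hom.cube, mid, pullback.map, pullback.lift_snd, pullback.lift_fst_assoc]

lemma cube_lst : φ.cube ≫ T.lst = S.lst ≫ φ.h := by
  simp [Hom.cube, lst, pullback.map, pullback.lift_snd, pullback.lift_snd_assoc]

lemma triple_cube {Z : 𝒞} (x y z : Z ⟶ S.D) (h : x ≫ S.d = y ≫ S.d) (h' : y ≫ S.c = z ≫ S.c) :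
    S.triple x y z h h' ≫ φ.cube = T.triple (x ≫ φ.h) (y ≫ φ.h) (z ≫ φ.h)
      (by simp only [Category.assoc, φ.d_comm, reassoc_of% h])
      (by simp only [Category.assoc, φ.c_comm, reassoc_of% h']) := by
  apply triple_hom_ext
  · rw [Category.assoc, cube_fst, ← Category.assoc, triple_fst, triple_fst]
  · rw [Category.assoc, cube_mid, ← Category.assoc, triple_mid, triple_mid]
  · rw [Category.assoc, cube_lst, ← Category.assoc, triple_lst, triple_lst]

end Cube

namespace IsPregroupoid

variable {S} {p : S.Kdc ⟶ S.D}

lemma of_triple (right : ∀ ⦃Z : 𝒞⦄ (x y : Z ⟶ S.D) (h : x ≫ S.d = y ≫ S.d),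
      S.triple x y y h rfl ≫ p = x)
    (left : ∀ ⦃Z : 𝒞⦄ (y z : Z ⟶ S.D) (h : y ≫ S.c = z ≫ S.c), S.triple y y z rfl h ≫ p = z)
    (hd : p ≫ S.d = S.lst ≫ S.d) (hc : p ≫ S.c = S.fst ≫ S.c) : S.IsPregroupoid p where
  e₁_m := by
    rw [← right S.d₁ S.d₂ pullback.condition, ← lift_e₁, pullback.lift_fst_snd, Category.id_comp]
  e₂_m := by
    rw [← left S.c₁ S.c₂ pullback.condition, ← lift_e₂, pullback.lift_fst_snd, Category.id_comp]
  m_d := by rw [hd, lst, Category.assoc]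
  m_c := by rw [hc, fst, Category.assoc]

variable (hp : S.IsPregroupoid p)
include hp

lemma triple_right {Z : 𝒞} (x y : Z ⟶ S.D) (h : x ≫ S.d = y ≫ S.d) :
    S.triple x y y h rfl ≫ p = x := by
  rw [← lift_e₁, Category.assoc, hp.e₁_m, pullback.lift_fst]

lemma triple_left {Z : 𝒞} (y z : Z ⟶ S.D) (h : y ≫ S.c = z ≫ S.c) :
    S.triple y y z rfl h ≫ p = z := by
  rw [← lift_e₂, Category.assoc, hp.e₂_m, pullback.lift_snd]

lemma comp_d : p ≫ S.d = S.lst ≫ S.d := by rw [hp.m_d, lst, Category.assoc]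

lemma comp_c : p ≫ S.c = S.fst ≫ S.c := by rw [hp.m_c, fst, Category.assoc]

variable {Z : 𝒞} (x y z : Z ⟶ S.D) (h : x ≫ S.d = y ≫ S.d) (h' : y ≫ S.c = z ≫ S.c)

lemma triple_d : (S.triple x y z h h' ≫ p) ≫ S.d = z ≫ S.d := by
  rw [Category.assoc, hp.comp_d, ← Category.assoc, triple_lst]

lemma triple_c : (S.triple x y z h h' ≫ p) ≫ S.c = x ≫ S.c := by
  rw [Category.assoc, hp.comp_c, ← Category.assoc, triple_fst]

end IsPregroupoid

/-- The reflexive graph with objects the elements of `D`, in which an arrow from `z` to `x` is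
an element `y` with `d x = d y` and `c y = c z`. -/
abbrev graph : RG 𝒞 where
  d := S.lst
  e := S.triple (𝟙 _) (𝟙 _) (𝟙 _) rfl rfl
  c := S.fst
  e_d := S.triple_lst _ _ _ _ _
  e_c := S.triple_fst _ _ _ _ _

/-- The morphism of reflexive graphs induced by a morphism of spans. -/
abbrev Hom.graph {S T : Span 𝒞} (φ : S ⟶ T) : S.graph ⟶ T.graph where
  f₁ := φ.cube
  f₀ := φ.h
  d_comm := cube_lst φ
  c_comm := cube_fst φ
  e_comm := by simp [triple_cube, comp_triple]

end Span

/-! ### Groupoids from pregroupoids -/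

section Groupoids

variable {𝒞 : Type u} [Category.{v} 𝒞] [HasLocalProducts 𝒞]

/-- The associativity `p(p(x, y, z), u, v) = p(x, y, p(z, u, v))` of a pregroupoid structure. -/
def Span.IsAssociative (S : Span 𝒞) (p : S.Kdc ⟶ S.D) : Prop :=
  ∀ ⦃Z : 𝒞⦄ (x y z u v : Z ⟶ S.D) (h₁ : x ≫ S.d = y ≫ S.d) (h₂ : y ≫ S.c = z ≫ S.c)
    (h₃ : z ≫ S.d = u ≫ S.d) (h₄ : u ≫ S.c = v ≫ S.c)
    (h₅ : (S.triple x y z h₁ h₂ ≫ p) ≫ S.d = u ≫ S.d)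
    (h₆ : y ≫ S.c = (S.triple z u v h₃ h₄ ≫ p) ≫ S.c),
    S.triple (S.triple x y z h₁ h₂ ≫ p) u v h₅ h₄ ≫ p =
      S.triple x y (S.triple z u v h₃ h₄ ≫ p) h₁ h₆ ≫ p

lemma RG.isLocalProductSquare (X : RG 𝒞) :
    IsLocalProductSquare X.d X.e X.c X.e X.π₁ X.e₁ X.π₂ X.e₂ :=
  isLocalProductSquare_pullback X.e_d X.e_c _ _

namespace Span.IsPregroupoid

variable {S : Span 𝒞} {p : S.Kdc ⟶ S.D} (hp : S.IsPregroupoid p)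
include hp

lemma isKiteMul_assoc_left
    (h₁ : (S.graph.π₁ ≫ p) ≫ S.d = (S.graph.π₂ ≫ S.mid) ≫ S.d)
    (h₂ : (S.graph.π₂ ≫ S.mid) ≫ S.c = (S.graph.π₂ ≫ S.lst) ≫ S.c) :
    IsKiteMul S S.graph.π₁ S.graph.e₁ S.graph.π₂ S.graph.e₂ p p (S.triple _ _ _ h₁ h₂ ≫ p) where
  e₁_m := by
    have H := S.graph.isLocalProductSquare
    simp only [← Category.assoc, comp_triple, H.e₁_p₁, H.e₁_p₂]
    simp [hp.triple_right]
  e₂_m := by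
    have H := S.graph.isLocalProductSquare
    simp only [← Category.assoc, comp_triple, H.e₂_p₁, H.e₂_p₂]
    simp [hp.triple_right, triple_components]
  m_d := by rw [hp.triple_d, Category.assoc, hp.comp_d]
  m_c := by rw [hp.triple_c, Category.assoc]

lemma isKiteMul_assoc_right
    (h₁ : (S.graph.π₁ ≫ S.fst) ≫ S.d = (S.graph.π₁ ≫ S.mid) ≫ S.d)
    (h₂ : (S.graph.π₁ ≫ S.mid) ≫ S.c = (S.graph.π₂ ≫ p) ≫ S.c) :
    IsKiteMul S S.graph.π₁ S.graph.e₁ S.graph.π₂ S.graph.e₂ p p (S.triple _ _ _ h₁ h₂ ≫ p) where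
  e₁_m := by
    have H := S.graph.isLocalProductSquare
    simp only [← Category.assoc, comp_triple, H.e₁_p₁, H.e₁_p₂]
    simp [hp.triple_right, triple_components]
  e₂_m := by
    have H := S.graph.isLocalProductSquare
    simp only [← Category.assoc, comp_triple, H.e₂_p₁, H.e₂_p₂]
    simp [hp.triple_left]
  m_d := by rw [hp.triple_d, Category.assoc]
  m_c := by rw [hp.triple_c, Category.assoc, hp.comp_c]

end Span.IsPregroupoid

lemma HasUniqueKiteMul.isAssociative {M : ObjectProperty (Span 𝒞)} (h : HasUniqueKiteMul M)
    {S : Span 𝒞} (hS : M S) {p : S.Kdc ⟶ S.D} (hp : S.IsPregroupoid p) : S.IsAssociative p := by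
  intro Z x y z u v h₁ h₂ h₃ h₄ _ _
  have H := S.graph.isLocalProductSquare
  have universal := h.eq H hS
    (hp.isKiteMul_assoc_left
      (by rw [Category.assoc, Category.assoc, hp.comp_d, ← S.fst_d, H.isPullback.w_assoc])
      (by rw [Category.assoc, Category.assoc, S.mid_c]))
    (hp.isKiteMul_assoc_right
      (by rw [Category.assoc, Category.assoc, S.fst_d])
      (by rw [Category.assoc, Category.assoc, hp.comp_c, S.mid_c, H.isPullback.w_assoc]))
  have w : S.triple x y z h₁ h₂ ≫ S.lst = S.triple z u v h₃ h₄ ≫ S.fst := by simp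
  simpa only [← Category.assoc, S.comp_triple, H.isPullback.lift_fst, H.isPullback.lift_snd,
    Span.triple_fst, Span.triple_mid, Span.triple_lst] using H.isPullback.lift _ _ w ≫= universal

namespace RG

variable (X : RG 𝒞)

/-- The ternary operation `p(x, y, z)` on generalized elements of `X` given by
`p : D(d, c) ⟶ C₁`. -/
def ternary (p : X.span.Kdc ⟶ X.C₁) {Z : 𝒞} (x y z : Z ⟶ X.C₁) (h : x ≫ X.d = y ≫ X.d)
    (h' : y ≫ X.c = z ≫ X.c) : Z ⟶ X.C₁ :=
  X.span.triple x y z h h' ≫ p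

variable {X} {p : X.span.Kdc ⟶ X.C₁}

lemma comp_ternary {W Z : 𝒞} (w : W ⟶ Z) (x y z : Z ⟶ X.C₁) (h : x ≫ X.d = y ≫ X.d)
    (h' : y ≫ X.c = z ≫ X.c) :
    w ≫ X.ternary p x y z h h' =
      X.ternary p (w ≫ x) (w ≫ y) (w ≫ z) (by simp [h]) (by simp [h']) :=
  (Category.assoc _ _ _).symm.trans (congrArg (· ≫ p) (X.span.comp_triple w x y z h h'))

variable (hp : X.span.IsPregroupoid p)
include hp

lemma ternary_right {Z : 𝒞} (x y : Z ⟶ X.C₁) (h : x ≫ X.d = y ≫ X.d) :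
    X.ternary p x y y h rfl = x :=
  hp.triple_right x y h

lemma ternary_left {Z : 𝒞} (y z : Z ⟶ X.C₁) (h : y ≫ X.c = z ≫ X.c) :
    X.ternary p y y z rfl h = z :=
  hp.triple_left y z h

variable {Z : 𝒞} (x y z : Z ⟶ X.C₁) (h : x ≫ X.d = y ≫ X.d) (h' : y ≫ X.c = z ≫ X.c)

lemma ternary_d : X.ternary p x y z h h' ≫ X.d = z ≫ X.d := hp.triple_d x y z h h'

lemma ternary_c : X.ternary p x y z h h' ≫ X.c = x ≫ X.c := hp.triple_c x y z h h'

lemma ternary_assoc (ha : X.span.IsAssociative p) (u v : Z ⟶ X.C₁) (h₃ : z ≫ X.d = u ≫ X.d)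
    (h₄ : u ≫ X.c = v ≫ X.c) :
    X.ternary p (X.ternary p x y z h h') u v ((ternary_d hp _ _ _ _ _).trans h₃) h₄ =
      X.ternary p x y (X.ternary p z u v h₃ h₄) h (h'.trans (ternary_c hp _ _ _ _ _).symm) :=
  ha x y z u v h h' h₃ h₄ _ _

/-- The unital multiplicative graph with multiplication `x y = p(x, 1, y)`. -/
abbrev toUMG : UMG 𝒞 where
  graph := X
  m := X.ternary p X.π₁ (X.π₁ ≫ X.d ≫ X.e) X.π₂ (by simp [X.e_d])
    (by simp [X.e_c, pullback.condition])
  m_d := ternary_d hp _ _ _ _ _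
  m_c := ternary_c hp _ _ _ _ _
  e₁_m := by
    have H := X.isLocalProductSquare
    simp only [comp_ternary, reassoc_of% H.e₁_p₁, H.e₁_p₁, H.e₁_p₂, ternary_right hp]
  e₂_m := by
    have H := X.isLocalProductSquare
    simp only [comp_ternary, reassoc_of% H.e₂_p₁, H.e₂_p₁, H.e₂_p₂, reassoc_of% X.e_d,
      ternary_left hp]

lemma toUMG_mul {Z : 𝒞} (x y : Z ⟶ X.C₁) (h : x ≫ X.d = y ≫ X.c) :
    (toUMG hp).mul x y h =
      X.ternary p x (x ≫ X.d ≫ X.e) y (by simp [X.e_d]) (by simp [X.e_c, h]) := by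
  simp only [UMG.mul, toUMG, comp_ternary, pullback.lift_fst, pullback.lift_fst_assoc,
    pullback.lift_snd]

lemma toUMG_isAssociative (ha : X.span.IsAssociative p) : (toUMG hp).IsAssociative := by
  intro Z x y z hxy hyz
  simp only [toUMG_mul]
  simp only [reassoc_of% ternary_d hp]
  exact ternary_assoc hp _ _ _ _ _ ha _ _ _ _

lemma toUMG_hasInverses (ha : X.span.IsAssociative p) : (toUMG hp).HasInverses := by
  let i : X.C₁ ⟶ X.C₁ := X.ternary p (X.d ≫ X.e) (𝟙 _) (X.c ≫ X.e) (by simp [X.e_d])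
    (by simp [X.e_c])
  have hd : i ≫ X.d = X.c := by simp [i, ternary_d hp, X.e_d]
  have hc : i ≫ X.c = X.d := by simp [i, ternary_c hp, X.e_c]
  refine ⟨i, hd, hc, ?_, ?_⟩
  · calc (toUMG hp).mul (𝟙 _) i _
      _ = X.ternary p (𝟙 _) (X.d ≫ X.e) i (by simp [X.e_d]) (by simp [X.e_c, hc]) := by
        simp only [toUMG_mul, Category.id_comp]
      _ = X.ternary p (X.ternary p (𝟙 _) (X.d ≫ X.e) (X.d ≫ X.e) (by simp [X.e_d]) rfl) (𝟙 _)
          (X.c ≫ X.e) (by simp [ternary_d hp, X.e_d]) (by simp [X.e_c]) :=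
        (ternary_assoc hp _ _ _ _ _ ha _ _ _ _).symm
      _ = X.c ≫ X.e := by simp only [ternary_right hp, ternary_left hp]
  · calc (toUMG hp).mul i (𝟙 _) _
      _ = X.ternary p i (X.c ≫ X.e) (𝟙 _) (by simp [X.e_d, hd]) (by simp [X.e_c]) := by
        simp only [toUMG_mul, reassoc_of% hd]
      _ = X.ternary p (X.d ≫ X.e) (𝟙 _) (X.ternary p (X.c ≫ X.e) (X.c ≫ X.e) (𝟙 _) rfl
          (by simp [X.e_c])) (by simp [X.e_d]) (by simp [ternary_c hp, X.e_c]) :=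
        ternary_assoc hp _ _ _ _ _ ha _ _ _ _
      _ = X.d ≫ X.e := by simp only [ternary_right hp, ternary_left hp]

end RG

lemma HasUniqueKiteMul.exists_groupoid {M : ObjectProperty (Span 𝒞)} (h : HasUniqueKiteMul M)
    {X : RG 𝒞} (hX : M X.span) : ∃ U : UMG 𝒞, U.graph = X ∧ U.IsAssociative ∧ U.HasInverses := by
  obtain ⟨p, hp⟩ := (h.existsUnique_isMul ((Span.toDiKite 𝒞).obj X.span) hX).exists
  have ha := h.isAssociative hX hp
  exact ⟨RG.toUMG hp, rfl, RG.toUMG_isAssociative hp ha, RG.toUMG_hasInverses hp ha⟩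

end Groupoids

/-! ### Natural pregroupoid structures -/

section NaturalPregroupoids

variable {𝒞 : Type u} [Category.{v} 𝒞] [HasLocalProducts 𝒞]

/-- The spans in `M` carry pregroupoid structures which are preserved by all morphisms of
spans. -/
def HasNaturalPregroupoids (M : ObjectProperty (Span 𝒞)) : Prop :=
  ∃ p : ∀ S, M S → (S.Kdc ⟶ S.D), (∀ (S : Span 𝒞) hS, S.IsPregroupoid (p S hS)) ∧
    ∀ ⦃S T : Span 𝒞⦄ hS hT (φ : S ⟶ T), p S hS ≫ φ.h = φ.cube ≫ p T hT

variable {M : ObjectProperty (Span 𝒞)}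

lemma hasNaturalPregroupoids_of_lift {G : M.FullSubcategory ⥤ MKite 𝒞}
    (hG : G ⋙ MKite.forget 𝒞 = M.ι ⋙ Span.toDiKite 𝒞) : HasNaturalPregroupoids M := by
  obtain ⟨m, hm, hnat⟩ := exists_natural_mul_of_lift hG
  exact ⟨fun S hS => m ⟨S, hS⟩, fun S hS => hm ⟨S, hS⟩,
    fun S T hS hT φ => hnat (ObjectProperty.homMk φ : (⟨S, hS⟩ : M.FullSubcategory) ⟶ ⟨T, hT⟩)⟩

lemma RG.f₂_π₁ {X Y : RG 𝒞} (φ : X ⟶ Y) : RG.Hom.f₂ φ ≫ Y.π₁ = X.π₁ ≫ φ.f₁ :=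
  pullback.lift_fst _ _ _

lemma RG.f₂_π₂ {X Y : RG 𝒞} (φ : X ⟶ Y) : RG.Hom.f₂ φ ≫ Y.π₂ = X.π₂ ≫ φ.f₁ :=
  pullback.lift_snd _ _ _

namespace Span

variable (S : Span 𝒞)

/-- The composable pair of arrows `(z, z, y)` and `(y, x, x)` of `S.graph` attached to a triple
`(x, y, z)`. The middle component of their product is `p(x, y, z)` for a pregroupoid structure
`p` on `S`. -/
def composablePair : S.Kdc ⟶ S.graph.C₂ :=
  S.graph.isLocalProductSquare.isPullback.lift
    (S.triple S.lst S.lst S.mid rfl S.mid_c.symm) (S.triple S.mid S.fst S.fst S.fst_d.symm rfl)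
    (by simp)

lemma composablePair_π₁ : S.composablePair ≫ S.graph.π₁ =
    S.triple S.lst S.lst S.mid rfl S.mid_c.symm :=
  IsPullback.lift_fst _ _ _ _

lemma composablePair_π₂ : S.composablePair ≫ S.graph.π₂ =
    S.triple S.mid S.fst S.fst S.fst_d.symm rfl :=
  IsPullback.lift_snd _ _ _ _

lemma triple_right_composablePair {Z : 𝒞} (x y : Z ⟶ S.D) (h : x ≫ S.d = y ≫ S.d) :
    S.triple x y y h rfl ≫ S.composablePair = S.triple y x x h.symm rfl ≫ S.graph.e₂ := by
  have H := S.graph.isLocalProductSquare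
  apply H.isPullback.hom_ext
  · rw [Category.assoc, Category.assoc, composablePair_π₁, H.e₂_p₁]
    simp [comp_triple]
  · rw [Category.assoc, Category.assoc, composablePair_π₂, H.e₂_p₂]
    simp [comp_triple]

lemma triple_left_composablePair {Z : 𝒞} (y z : Z ⟶ S.D) (h : y ≫ S.c = z ≫ S.c) :
    S.triple y y z rfl h ≫ S.composablePair = S.triple z z y rfl h.symm ≫ S.graph.e₁ := by
  have H := S.graph.isLocalProductSquare
  apply H.isPullback.hom_ext
  · rw [Category.assoc, Category.assoc, composablePair_π₁, H.e₁_p₁]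
    simp [comp_triple]
  · rw [Category.assoc, Category.assoc, composablePair_π₂, H.e₁_p₂]
    simp [comp_triple]

lemma composablePair_f₂ {S T : Span 𝒞} (φ : S ⟶ T) :
    S.composablePair ≫ RG.Hom.f₂ (Hom.graph φ) = φ.cube ≫ T.composablePair := by
  apply T.graph.isLocalProductSquare.isPullback.hom_ext
  · rw [Category.assoc, Category.assoc, composablePair_π₁, RG.f₂_π₁,
      reassoc_of% S.composablePair_π₁, triple_cube, comp_triple]
    simp only [cube_lst, cube_mid]
  · rw [Category.assoc, Category.assoc, composablePair_π₂, RG.f₂_π₂,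
      reassoc_of% S.composablePair_π₂, triple_cube, comp_triple]
    simp only [cube_fst, cube_mid]

lemma isPregroupoid_of_mul {m : S.graph.C₂ ⟶ S.Kdc}
    (hm : ((RG.toDiKite 𝒞).obj S.graph).IsMul m) :
    S.IsPregroupoid (S.composablePair ≫ m ≫ S.mid) := by
  have e₁_m : S.graph.e₁ ≫ m = 𝟙 _ := hm.e₁_m
  have e₂_m : S.graph.e₂ ≫ m = 𝟙 _ := hm.e₂_m
  have m_d : m ≫ S.lst = S.graph.π₂ ≫ S.lst := hm.m_d.trans (by simp [RG.toDiKite, RG.span])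
  have m_c : m ≫ S.fst = S.graph.π₁ ≫ S.fst := hm.m_c.trans (by simp [RG.toDiKite, RG.span])
  refine IsPregroupoid.of_triple (fun Z x y h => ?_) (fun Z y z h => ?_) ?_ ?_
  · rw [reassoc_of% S.triple_right_composablePair, reassoc_of% e₂_m, triple_mid]
  · rw [reassoc_of% S.triple_left_composablePair, reassoc_of% e₁_m, triple_mid]
  · rw [Category.assoc, Category.assoc, ← S.fst_d, reassoc_of% m_c,
      reassoc_of% S.composablePair_π₁, ← Category.assoc, triple_fst]
  · rw [Category.assoc, Category.assoc, S.mid_c, reassoc_of% m_d,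
      reassoc_of% S.composablePair_π₂, ← Category.assoc, triple_lst]

end Span

lemma hasNaturalPregroupoids_of_graph_lift (hM : ∀ S : Span 𝒞, M S → M S.graph.span)
    {G : (graphsIn M).FullSubcategory ⥤ MKite 𝒞}
    (hG : G ⋙ MKite.forget 𝒞 = (graphsIn M).ι ⋙ RG.toDiKite 𝒞) : HasNaturalPregroupoids M := by
  obtain ⟨m, hm, hnat⟩ := exists_natural_mul_of_lift hG
  let graphIn (S : Span 𝒞) (hS : M S) : (graphsIn M).FullSubcategory := ⟨S.graph, hM S hS⟩
  let mul (S : Span 𝒞) (hS : M S) : S.graph.C₂ ⟶ S.Kdc := m (graphIn S hS)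
  have mul_natural {S T : Span 𝒞} (hS : M S) (hT : M T) (φ : S ⟶ T) :
      mul S hS ≫ φ.cube = RG.Hom.f₂ (Span.Hom.graph φ) ≫ mul T hT :=
    hnat (ObjectProperty.homMk (Span.Hom.graph φ) : graphIn S hS ⟶ graphIn T hT)
  refine ⟨fun S hS => S.composablePair ≫ mul S hS ≫ S.mid,
    fun S hS => S.isPregroupoid_of_mul (hm (graphIn S hS)), fun S T hS hT φ => ?_⟩
  calc (S.composablePair ≫ mul S hS ≫ S.mid) ≫ φ.h
      = S.composablePair ≫ (mul S hS ≫ φ.cube) ≫ T.mid := by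
        simp only [Category.assoc, Span.cube_mid]
    _ = (S.composablePair ≫ RG.Hom.f₂ (Span.Hom.graph φ)) ≫ mul T hT ≫ T.mid := by
        rw [mul_natural hS hT φ]; simp only [Category.assoc]
    _ = φ.cube ≫ T.composablePair ≫ mul T hT ≫ T.mid := by
        rw [Span.composablePair_f₂, Category.assoc]

lemma hasNaturalPregroupoids_of_hasSection_preGrpd
    (h : HasSection (restrict (PreGrpd.forget 𝒞) M)) : HasNaturalPregroupoids M := by
  obtain ⟨G, hG⟩ := h.exists_lift (L := PreGrpd.toMKite 𝒞) (U := MKite.forget 𝒞)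
    (K := Span.toDiKite 𝒞) rfl
  exact hasNaturalPregroupoids_of_lift hG

lemma hasNaturalPregroupoids_of_hasSection_mKite
    (h : HasSection (restrict (MKite.forget 𝒞) (kitesIn M))) : HasNaturalPregroupoids M := by
  obtain ⟨G, hG⟩ := h.exists_lift (L := 𝟭 _) (U := MKite.forget 𝒞) (K := 𝟭 _) rfl
  let J : M.FullSubcategory ⥤ (kitesIn M).FullSubcategory :=
    (kitesIn M).lift (M.ι ⋙ Span.toDiKite 𝒞) fun S => S.property
  exact hasNaturalPregroupoids_of_lift (G := J ⋙ G) (congrArg (J ⋙ ·) hG)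

lemma hasNaturalPregroupoids_of_hasSection_graph (hM : ∀ S : Span 𝒞, M S → M S.graph.span)
    {𝒳 : Type u₁} [Category.{v₁} 𝒳] {L : 𝒳 ⥤ UMG 𝒞}
    (h : HasSection (restrict (L ⋙ UMG.forget 𝒞) (graphsIn M))) : HasNaturalPregroupoids M := by
  obtain ⟨G, hG⟩ := h.exists_lift (L := L ⋙ UMG.toMKite 𝒞) (U := MKite.forget 𝒞)
    (K := RG.toDiKite 𝒞) rfl
  exact hasNaturalPregroupoids_of_graph_lift hM hG

end NaturalPregroupoids

/-! ### Isomorphisms of categories from unique multiplications -/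

section Isomorphisms

variable {𝒞 : Type u} [Category.{v} 𝒞] [HasLocalProducts 𝒞] {M : ObjectProperty (Span 𝒞)}

namespace HasUniqueKiteMul

lemma isIsoOfCategories_preGrpd (h : HasUniqueKiteMul M) :
    IsIsoOfCategories (restrict (PreGrpd.forget 𝒞) M) := by
  refine isIsoOfCategories_restrict _ _ (fun S hS => ?_) ?_ fun X Y _ hY φ =>
    ⟨⟨φ, h.isMul_natural hY ((PreGrpd.toMKite 𝒞).obj X).isMul ((PreGrpd.toMKite 𝒞).obj Y).isMul
      ((Span.toDiKite 𝒞).map φ)⟩, rfl⟩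
  · obtain ⟨p, hp⟩ := (h.existsUnique_isMul ((Span.toDiKite 𝒞).obj S) hS).exists
    exact ⟨⟨S, p, hp.e₁_m, hp.e₂_m, hp.m_d, hp.m_c⟩, rfl⟩
  · rintro ⟨S, p, hp₁, hp₂, hpd, hpc⟩ ⟨S', q, hq₁, hq₂, hqd, hqc⟩ hS (rfl : S = S')
    obtain rfl := (h.existsUnique_isMul ((Span.toDiKite 𝒞).obj S) hS).unique
      ⟨hp₁, hp₂, hpd, hpc⟩ ⟨hq₁, hq₂, hqd, hqc⟩
    rfl

lemma umg_ext (h : HasUniqueKiteMul M) {U V : UMG 𝒞} (hU : M U.graph.span)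
    (e : U.graph = V.graph) : U = V := by
  have hm := ((UMG.toMKite 𝒞).obj U).isMul
  have hn := ((UMG.toMKite 𝒞).obj V).isMul
  obtain ⟨X, m, _, _, _, _⟩ := U
  obtain ⟨_, n, _, _, _, _⟩ := V
  obtain rfl : X = _ := e
  obtain rfl : m = n := (h.existsUnique_isMul ((RG.toDiKite 𝒞).obj X) hU).unique hm hn
  rfl

lemma isIsoOfCategories_graph (h : HasUniqueKiteMul M) {𝒳 : Type u₁} [Category.{v₁} 𝒳]
    (L : 𝒳 ⥤ UMG 𝒞) [L.Full] [L.Faithful] (inj : Function.Injective L.obj)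
    (surj : ∀ U : UMG 𝒞, U.IsAssociative → U.HasInverses → ∃ x, L.obj x = U) :
    IsIsoOfCategories (restrict (L ⋙ UMG.forget 𝒞) (graphsIn M)) := by
  refine isIsoOfCategories_restrict _ _ (fun X hX => ?_)
    (fun x y hx e => inj (h.umg_ext hx e)) fun x y _ hy φ => ?_
  · obtain ⟨U, rfl, ha, hi⟩ := h.exists_groupoid hX
    obtain ⟨x, rfl⟩ := surj U ha hi
    exact ⟨x, rfl⟩
  · let K := (UMG.toMKite 𝒞).obj (L.obj x)
    let K' := (UMG.toMKite 𝒞).obj (L.obj y)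
    have natural := h.isMul_natural (L := K'.kite) hy K.isMul K'.isMul ((RG.toDiKite 𝒞).map φ)
    exact ⟨L.preimage ⟨φ, natural⟩, congrArg UMG.Hom.toHom (L.map_preimage _)⟩

end HasUniqueKiteMul

end Isomorphisms

/-! ### The kite condition -/

section KiteCondition

variable {𝒞 : Type u} [Category.{v} 𝒞]

/-- The span obtained by exchanging the two legs of `S`. -/
abbrev Span.swap (S : Span 𝒞) : Span 𝒞 where
  d := S.c
  c := S.d

variable [HasLocalProducts 𝒞]

/-- The closure properties of a class of spans under which the conditions of
`unificationConditions` are equivalent. -/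
structure IsAdequate (M : ObjectProperty (Span 𝒞)) : Prop where
  swap : ∀ S, M S → M S.swap
  graph : ∀ S : Span 𝒞, M S → M S.graph.span
  localProduct : ∀ ⦃A B C E : 𝒞⦄ ⦃f : A ⟶ B⦄ ⦃r : B ⟶ A⦄ ⦃g : C ⟶ B⦄ ⦃s : B ⟶ C⦄ ⦃p₁ : E ⟶ A⦄
    ⦃e₁ : A ⟶ E⦄ ⦃p₂ : E ⟶ C⦄ ⦃e₂ : C ⟶ E⦄ (H : IsLocalProductSquare f r g s p₁ e₁ p₂ e₂),
    M H.span

lemma Span.IsPregroupoid.isKiteMul {E S : Span 𝒞} {p : S.Kdc ⟶ S.D} (hp : S.IsPregroupoid p)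
    {e₁ : E.D₀ ⟶ E.D} {e₂ : E.D₁ ⟶ E.D} (he₁ : e₁ ≫ E.d = 𝟙 _) (he₂ : e₂ ≫ E.c = 𝟙 _)
    {α : E.D₀ ⟶ S.D} {β : E.D ⟶ S.D} {γ : E.D₁ ⟶ S.D}
    (hα : e₂ ≫ β = e₂ ≫ E.d ≫ α) (hγ : e₁ ≫ β = e₁ ≫ E.c ≫ γ)
    (hd : (E.d ≫ α) ≫ S.d = β ≫ S.d) (hc : β ≫ S.c = (E.c ≫ γ) ≫ S.c) :
    IsKiteMul S E.d e₁ E.c e₂ α γ (S.triple (E.d ≫ α) β (E.c ≫ γ) hd hc ≫ p) where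
  e₁_m := by
    rw [← Category.assoc, comp_triple]
    simp only [hγ, hp.triple_right, reassoc_of% he₁]
  e₂_m := by
    rw [← Category.assoc, comp_triple]
    simp only [hα, hp.triple_left, reassoc_of% he₂]
  m_d := by rw [hp.triple_d, Category.assoc]
  m_c := by rw [hp.triple_c, Category.assoc]

lemma Span.IsPregroupoid.triple_eq_id {E : Span 𝒞} {p : E.Kdc ⟶ E.D} (hp : E.IsPregroupoid p)
    (hE : JointlyMonic E.d E.c) {e₁ : E.D₁ ⟶ E.D} {e₂ : E.D₀ ⟶ E.D} {b : E.D ⟶ E.D}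
    (he₁ : e₁ ≫ E.c = 𝟙 _) (he₂ : e₂ ≫ E.d = 𝟙 _)
    (hd : (E.c ≫ e₁) ≫ E.d = b ≫ E.d) (hc : b ≫ E.c = (E.d ≫ e₂) ≫ E.c) :
    E.triple (E.c ≫ e₁) b (E.d ≫ e₂) hd hc ≫ p = 𝟙 E.D := by
  apply hE
  · rw [hp.triple_d, Category.assoc, he₂, Category.comp_id, Category.id_comp]
  · rw [hp.triple_c, Category.assoc, he₁, Category.comp_id, Category.id_comp]

variable {M : ObjectProperty (Span 𝒞)}

lemma HasNaturalPregroupoids.kiteCondition (hM : ∀ S, M S → M S.swap)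
    (h : HasNaturalPregroupoids M) : KiteCondition M := by
  obtain ⟨p, hp, natural⟩ := h
  intro E S hE hS hmono e₁ e₂ α β γ he₁ he₂ comm hα hγ hd hc
  have e₂_β : e₂ ≫ β = e₂ ≫ E.d ≫ α := by
    rw [← hα, Category.assoc, Category.assoc, reassoc_of% he₂]
  have e₁_β : e₁ ≫ β = e₁ ≫ E.c ≫ γ := by
    rw [← hγ, Category.assoc, Category.assoc, reassoc_of% he₁]
  have β_d : (E.d ≫ α) ≫ S.d = β ≫ S.d := by
    rw [Category.assoc, hd, ← hα, Category.assoc _ α]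
  have β_c : β ≫ S.c = (E.c ≫ γ) ≫ S.c := by
    rw [Category.assoc, hc, ← hγ, Category.assoc _ γ]
  have mul := (hp S hS).isKiteMul he₁ he₂ e₂_β e₁_β β_d β_c
  refine ⟨_, ⟨mul.e₁_m, mul.e₂_m, mul.m_d, mul.m_c⟩, ?_⟩
  rintro m ⟨hm₁, hm₂, hmd, hmc⟩
  -- Every `x` in `E` is `p (e₁ d x) (e₂ c (e₁ d x)) (e₂ c x)` in the swapped span, and `m`
  -- underlies a morphism from it to `S`, which preserves `p`.
  let φ : E.swap ⟶ S := ⟨m, γ ≫ S.d, α ≫ S.c, hmd, hmc⟩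
  have b_c : (E.d ≫ e₁) ≫ E.c = (E.d ≫ e₁ ≫ E.c ≫ e₂) ≫ E.c := by simp [he₂]
  have b_d : (E.d ≫ e₁ ≫ E.c ≫ e₂) ≫ E.d = (E.c ≫ e₂) ≫ E.d := by
    simpa [he₁] using comm.symm =≫ E.d
  have b_m : (E.d ≫ e₁ ≫ E.c ≫ e₂) ≫ m = β := by
    rw [← hγ]
    simp only [Category.assoc, hm₂]
  have id_eq := (hp _ (hM E hE)).triple_eq_id hmono.swap he₁ he₂ b_c b_d
  calc m = 𝟙 _ ≫ φ.h := (Category.id_comp m).symm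
    _ = E.swap.triple _ _ _ b_c b_d ≫ φ.cube ≫ p S hS := by
      rw [← id_eq, Category.assoc, natural (hM E hE) hS φ]
    _ = S.triple (E.d ≫ α) β (E.c ≫ γ) β_d β_c ≫ p S hS := by
      rw [← Category.assoc, Span.triple_cube]
      simp only [φ, b_m, Category.assoc, hm₁, hm₂]

lemma KiteCondition.hasUniqueKiteMul (hM : IsAdequate M) (h : KiteCondition M) :
    HasUniqueKiteMul M := by
  intro A B C E f r g s p₁ e₁ p₂ e₂ H S hS α γ hβ hα hγ
  have e₁_p₂ := H.e₁_p₂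
  have e₂_p₁ := H.e₂_p₁
  have w := H.isPullback.w
  have comm : (p₂ ≫ e₂) ≫ p₁ ≫ e₁ = (p₁ ≫ e₁) ≫ p₂ ≫ e₂ := by
    simp only [Category.assoc, reassoc_of% e₁_p₂, reassoc_of% e₂_p₁, reassoc_of% w, H.r_e₁]
  have β_eq : (p₁ ≫ e₁ ≫ p₂) ≫ γ = (p₂ ≫ e₂ ≫ p₁) ≫ α := by
    simp only [Category.assoc, reassoc_of% e₁_p₂, reassoc_of% e₂_p₁, reassoc_of% w, hβ]
  have β_d : p₁ ≫ α ≫ S.d = (p₂ ≫ e₂ ≫ p₁) ≫ α ≫ S.d := by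
    simp only [Category.assoc, reassoc_of% e₂_p₁, ← reassoc_of% w, ← hα]
  have β_c : p₂ ≫ γ ≫ S.c = (p₁ ≫ e₁ ≫ p₂) ≫ γ ≫ S.c := by
    simp only [Category.assoc, reassoc_of% e₁_p₂, reassoc_of% w, ← hγ]
  obtain ⟨m, ⟨hm₁, hm₂, hmd, hmc⟩, unique⟩ := h H.span S (hM.localProduct H) hS
    (jointlyMonic_of_isPullback H.isPullback) e₁ e₂ α _ γ H.e₁_p₁ H.e₂_p₂ comm rfl β_eq β_d β_c
  exact ⟨m, ⟨hm₁, hm₂, hmd, hmc⟩, fun n hn => unique n ⟨hn.e₁_m, hn.e₂_m, hn.m_d, hn.m_c⟩⟩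

lemma hasUniqueKiteMul_iff_hasNaturalPregroupoids (hM : IsAdequate M) :
    HasUniqueKiteMul M ↔ HasNaturalPregroupoids M :=
  ⟨fun h => hasNaturalPregroupoids_of_hasSection_preGrpd h.isIsoOfCategories_preGrpd.hasSection,
    fun h => (h.kiteCondition hM.swap).hasUniqueKiteMul hM⟩

lemma isIsoOfCategories_iff_and_hasSection_iff {𝒳 : Type u₁} [Category.{v₁} 𝒳] {𝒴 : Type u₂}
    [Category.{v₂} 𝒴] {F : 𝒳 ⥤ 𝒴} (hM : IsAdequate M)
    (iso : HasUniqueKiteMul M → IsIsoOfCategories F)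
    (natural : HasSection F → HasNaturalPregroupoids M) :
    (IsIsoOfCategories F ↔ HasUniqueKiteMul M) ∧ (HasSection F ↔ HasUniqueKiteMul M) := by
  have unique (h : HasSection F) : HasUniqueKiteMul M :=
    (hasUniqueKiteMul_iff_hasNaturalPregroupoids hM).2 (natural h)
  exact ⟨⟨fun h => unique h.hasSection, iso⟩, ⟨unique, fun h => (iso h).hasSection⟩⟩

lemma unificationConditions_iff (hM : IsAdequate M) :
    ∀ P ∈ unificationConditions M, (P ↔ HasUniqueKiteMul M) := by
  obtain ⟨grpd, grpd'⟩ := isIsoOfCategories_iff_and_hasSection_iff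
    (F := restrict (InternalGrpd.forget 𝒞) (graphsIn M)) hM
    (fun h => h.isIsoOfCategories_graph (isInternalGrpd 𝒞).ι
      (fun _ _ => ObjectProperty.FullSubcategory.ext) fun U ha hi => ⟨⟨U, ha, hi⟩, rfl⟩)
    (hasNaturalPregroupoids_of_hasSection_graph hM.graph)
  obtain ⟨cat, cat'⟩ := isIsoOfCategories_iff_and_hasSection_iff
    (F := restrict (InternalCat.forget 𝒞) (graphsIn M)) hM
    (fun h => h.isIsoOfCategories_graph (isInternalCat 𝒞).ι
      (fun _ _ => ObjectProperty.FullSubcategory.ext) fun U ha _ => ⟨⟨U, ha⟩, rfl⟩)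
    (hasNaturalPregroupoids_of_hasSection_graph hM.graph)
  obtain ⟨umg, umg'⟩ := isIsoOfCategories_iff_and_hasSection_iff
    (F := restrict (UMG.forget 𝒞) (graphsIn M)) hM
    (fun h => h.isIsoOfCategories_graph (𝟭 _) (fun _ _ => id) fun U _ _ => ⟨U, rfl⟩)
    (hasNaturalPregroupoids_of_hasSection_graph hM.graph (L := 𝟭 _))
  obtain ⟨preGrpd, preGrpd'⟩ := isIsoOfCategories_iff_and_hasSection_iff hM
    HasUniqueKiteMul.isIsoOfCategories_preGrpd hasNaturalPregroupoids_of_hasSection_preGrpd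
  obtain ⟨mKite, mKite'⟩ := isIsoOfCategories_iff_and_hasSection_iff hM
    HasUniqueKiteMul.isIsoOfCategories_mKite hasNaturalPregroupoids_of_hasSection_mKite
  have kite : KiteCondition M ↔ HasUniqueKiteMul M :=
    ⟨fun h => h.hasUniqueKiteMul hM, fun h =>
      ((hasUniqueKiteMul_iff_hasNaturalPregroupoids hM).1 h).kiteCondition hM.swap⟩
  simp only [unificationConditions, List.mem_cons, List.not_mem_nil, or_false,
    forall_eq_or_imp, forall_eq]
  exact ⟨grpd, grpd', cat, cat', umg, umg', preGrpd, preGrpd', mKite, mKite', kite⟩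

end KiteCondition

/-! ### The three classes of spans -/

section Classes

variable {𝒞 : Type u} [Category.{v} 𝒞] [HasLocalProducts 𝒞]

lemma Span.jointlyMonic_graph {S : Span 𝒞} (hS : JointlyMonic S.d S.c) :
    JointlyMonic S.lst S.fst := by
  intro Z x y h₁ h₂
  refine triple_hom_ext h₂ (hS _ _ ?_ ?_) h₁
  · rw [Category.assoc, Category.assoc, ← S.fst_d, reassoc_of% h₂]
  · rw [Category.assoc, Category.assoc, S.mid_c, reassoc_of% h₁]

lemma Span.jointlyStronglyMonic_graph {S : Span 𝒞} (hS : JointlyStronglyMonic S.d S.c) :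
    JointlyStronglyMonic S.lst S.fst := by
  apply jointlyStronglyMonic_of_exists
  intro X₁ X₂ Y e₁ e₂ he f₁ f₂ z x h₁ h₂ h₃ h₄
  have mid_d {X : 𝒞} {e : X ⟶ Y} {f : X ⟶ S.Kdc} (h : f ≫ S.fst = e ≫ x) :
      (f ≫ S.mid) ≫ S.d = e ≫ x ≫ S.d := by
    rw [Category.assoc, ← S.fst_d, reassoc_of% h]
  have mid_c {X : 𝒞} {e : X ⟶ Y} {f : X ⟶ S.Kdc} (h : f ≫ S.lst = e ≫ z) :
      (f ≫ S.mid) ≫ S.c = e ≫ z ≫ S.c := by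
    rw [Category.assoc, S.mid_c, reassoc_of% h]
  obtain ⟨y, ⟨hy₁, hy₂, hyd, hyc⟩, -⟩ := hS e₁ e₂ he (f₁ ≫ S.mid) (f₂ ≫ S.mid) (x ≫ S.d)
    (z ≫ S.c) (mid_d h₂) (mid_c h₁) (mid_d h₄) (mid_c h₃)
  refine ⟨S.triple x y z hyd.symm hyc, ?_, ?_, S.triple_lst _ _ _ _ _, S.triple_fst _ _ _ _ _⟩
  · apply triple_hom_ext <;> simp [h₁, h₂, hy₁]
  · apply triple_hom_ext <;> simp [h₃, h₄, hy₂]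

lemma isAdequate_M₀ : IsAdequate (M₀ 𝒞) :=
  ⟨fun _ _ => trivial, fun _ _ => trivial, fun _ _ _ _ _ _ _ _ _ _ _ _ _ => trivial⟩

lemma isAdequate_M₁ : IsAdequate (M₁ 𝒞) where
  swap _ := JointlyMonic.swap
  graph _ := Span.jointlyMonic_graph
  localProduct _ _ _ _ _ _ _ _ _ _ _ _ H := jointlyMonic_of_isPullback H.isPullback

lemma isAdequate_M₂ : IsAdequate (M₂ 𝒞) where
  swap _ := JointlyStronglyMonic.swap
  graph _ := Span.jointlyStronglyMonic_graph
  localProduct _ _ _ _ _ _ _ _ _ _ _ _ H := jointlyStronglyMonic_of_isPullback H.isPullback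

end Classes

/-! ### The naturally Mal'tsev case -/

section NaturallyMaltsev

variable {𝒞 : Type u} [Category.{v} 𝒞]

section

variable [HasLocalProducts 𝒞]

variable (𝒞) in
lemma isNaturallyMaltsev_iff : IsNaturallyMaltsev 𝒞 ↔ HasUniqueKiteMul (M₀ 𝒞) :=
  (isIsoOfCategories_restrict_iff (P := graphsIn (M₀ 𝒞)) _ fun _ => trivial).symm.trans
    (unificationConditions_iff isAdequate_M₀ _ List.mem_cons_self)

/-- The span `1 ⟵ D ⟶ 1`, whose pregroupoid structures are the Mal'tsev operations on `D`. -/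
abbrev terminalSpan [HasBinaryProducts 𝒞] [HasTerminal 𝒞] (D : 𝒞) : Span 𝒞 :=
  have : HasPullback (terminal.from D) (terminal.from D) :=
    (IsPullback.of_isLimit_binaryFan_of_isTerminal (prodIsProd D D) terminalIsTerminal).hasPullback
  { d := terminal.from D, c := terminal.from D }

lemma HasNaturalPregroupoids.hasNaturalMaltsevOperation [HasBinaryProducts 𝒞] [HasTerminal 𝒞]
    (h : HasNaturalPregroupoids (M₀ 𝒞)) : HasNaturalMaltsevOperation 𝒞 := by
  obtain ⟨p, hp, natural⟩ := h
  let q (D : 𝒞) : D ⨯ (D ⨯ D) ⟶ (terminalSpan D).Kdc :=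
    (terminalSpan D).triple prod.fst (prod.snd ≫ prod.fst) (prod.snd ≫ prod.snd)
      (Subsingleton.elim _ _) (Subsingleton.elim _ _)
  have lift_q {Z D : 𝒞} (x y z : Z ⟶ D) : prod.lift x (prod.lift y z) ≫ q D =
      (terminalSpan D).triple x y z (Subsingleton.elim _ _) (Subsingleton.elim _ _) := by
    apply Span.triple_hom_ext <;> simp [q, prod.lift_fst, prod.lift_snd, prod.lift_snd_assoc]
  refine ⟨fun D => q D ≫ p (terminalSpan D) trivial, fun D D' h => ?_, fun Z D x y => ⟨?_, ?_⟩⟩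
  · let φ : terminalSpan D ⟶ terminalSpan D' :=
      ⟨h, 𝟙 _, 𝟙 _, Subsingleton.elim _ _, Subsingleton.elim _ _⟩
    have q_cube : prod.map h (prod.map h h) ≫ q D' = q D ≫ φ.cube := by
      simp [q, φ, Span.comp_triple, Span.triple_cube]
    rw [reassoc_of% q_cube, ← natural trivial trivial φ, Category.assoc]
  · rw [reassoc_of% lift_q x y y]
    exact (hp (terminalSpan _) trivial).triple_right x y _
  · rw [reassoc_of% lift_q x x y]
    exact (hp (terminalSpan _) trivial).triple_left x y _

lemma HasNaturalMaltsevOperation.hasNaturalPregroupoids [HasBinaryProducts 𝒞]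
    (h : HasNaturalMaltsevOperation 𝒞) (M : ObjectProperty (Span 𝒞)) :
    HasNaturalPregroupoids M := by
  obtain ⟨p, natural, hp⟩ := h
  have lift_comp {Z D D' : 𝒞} (x y z : Z ⟶ D) (h : D ⟶ D') :
      (prod.lift x (prod.lift y z) ≫ p D) ≫ h =
        prod.lift (x ≫ h) (prod.lift (y ≫ h) (z ≫ h)) ≫ p D' := by
    rw [Category.assoc, ← natural h]
    simp
  refine ⟨fun S _ => prod.lift S.fst (prod.lift S.mid S.lst) ≫ p S.D, fun S _ => ?_,
    fun S T _ _ φ => ?_⟩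
  · refine .of_triple (fun Z x y h => ?_) (fun Z y z h => ?_) ?_ ?_
    · simp [← Category.assoc, (hp x y).1]
    · simp [← Category.assoc, (hp y z).2]
    · rw [lift_comp, S.fst_d, (hp _ _).2]
    · rw [lift_comp, S.mid_c, (hp _ _).1]
  · rw [lift_comp, ← Category.assoc]
    simp only [prod.comp_lift, Span.cube_fst, Span.cube_mid, Span.cube_lst]

lemma hasNaturalMaltsevOperation_iff [HasBinaryProducts 𝒞] [HasTerminal 𝒞] :
    HasNaturalMaltsevOperation 𝒞 ↔ HasUniqueKiteMul (M₀ 𝒞) :=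
  Iff.trans ⟨fun h => h.hasNaturalPregroupoids _, fun h => h.hasNaturalMaltsevOperation⟩
    (hasUniqueKiteMul_iff_hasNaturalPregroupoids isAdequate_M₀).symm

end

lemma isPushout_of_retract {A B C E Q : 𝒞} {r : B ⟶ A} {s : B ⟶ C} {i₁ : A ⟶ Q} {i₂ : C ⟶ Q}
    (hQ : IsPushout r s i₁ i₂) {m : E ⟶ Q} {k : Q ⟶ E} (mk : m ≫ k = 𝟙 E)
    (h₁ : (i₁ ≫ k) ≫ m = i₁) (h₂ : (i₂ ≫ k) ≫ m = i₂) : IsPushout r s (i₁ ≫ k) (i₂ ≫ k) := by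
  have km : k ≫ m = 𝟙 Q := hQ.hom_ext (by simpa using h₁) (by simpa using h₂)
  exact hQ.of_iso' (Iso.refl _) (Iso.refl _) (Iso.refl _) ⟨m, k, mk, km⟩ (by simp) (by simp)
    (by simpa using h₁.symm) (by simpa using h₂.symm)

lemma HasUniqueKiteMul.isPushout [HasLocalProducts 𝒞] (h : HasUniqueKiteMul (M₀ 𝒞))
    {A B C E Q : 𝒞} {f : A ⟶ B} {r : B ⟶ A} {g : C ⟶ B} {s : B ⟶ C}
    {p₁ : E ⟶ A} {e₁ : A ⟶ E} {p₂ : E ⟶ C} {e₂ : C ⟶ E}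
    (H : IsLocalProductSquare f r g s p₁ e₁ p₂ e₂) {i₁ : A ⟶ Q} {i₂ : C ⟶ Q}
    (hQ : IsPushout r s i₁ i₂) : IsPushout r s e₁ e₂ := by
  let k : Q ⟶ E := hQ.desc e₁ e₂ H.r_e₁
  have i₁_k : i₁ ≫ k = e₁ := hQ.inl_desc _ _ _
  have i₂_k : i₂ ≫ k = e₂ := hQ.inr_desc _ _ _
  have d_split : i₂ ≫ k ≫ p₂ = 𝟙 C := by rw [reassoc_of% i₂_k, H.e₂_p₂]
  have c_split : i₁ ≫ k ≫ p₁ = 𝟙 A := by rw [reassoc_of% i₁_k, H.e₁_p₁]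
  have : IsSplitEpi (k ≫ p₂) := ⟨⟨⟨i₂, d_split⟩⟩⟩
  have : IsSplitEpi (k ≫ p₁) := ⟨⟨⟨i₁, c_split⟩⟩⟩
  let S : Span 𝒞 := { d := k ≫ p₂, c := k ≫ p₁ }
  obtain ⟨m, hm⟩ := (h H S trivial i₁ i₂ hQ.w
    (by simp only [S, reassoc_of% i₁_k, H.e₁_p₂, reassoc_of% H.r_f])
    (by simp only [S, reassoc_of% i₂_k, H.e₂_p₁, reassoc_of% H.s_g])).exists
  have mk : m ≫ k = 𝟙 E := by
    apply H.isPullback.hom_ext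
    · simpa [S, c_split] using hm.m_c
    · simpa [S, d_split] using hm.m_d
  simpa only [i₁_k, i₂_k] using isPushout_of_retract hQ mk (by rw [i₁_k, hm.e₁_m])
    (by rw [i₂_k, hm.e₂_m])

lemma LocalProductsAreLocalCoproducts.hasUniqueKiteMul (h : LocalProductsAreLocalCoproducts 𝒞)
    (M : ObjectProperty (Span 𝒞)) : HasUniqueKiteMul M := by
  intro A B C E f r g s p₁ e₁ p₂ e₂ H S _ α γ hβ hα hγ
  have hE := h _ _ _ _ _ _ _ _ H
  have mul : IsKiteMul S p₁ e₁ p₂ e₂ α γ (hE.desc α γ hβ) :=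
    { e₁_m := hE.inl_desc _ _ _
      e₂_m := hE.inr_desc _ _ _
      m_d := by
        apply hE.hom_ext
        · rw [hE.inl_desc_assoc, reassoc_of% H.e₁_p₂, ← reassoc_of% hβ, ← hα]
        · rw [hE.inr_desc_assoc, reassoc_of% H.e₂_p₂]
      m_c := by
        apply hE.hom_ext
        · rw [hE.inl_desc_assoc, reassoc_of% H.e₁_p₁]
        · rw [hE.inr_desc_assoc, reassoc_of% H.e₂_p₁, reassoc_of% hβ, ← hγ] }
  exact ⟨_, mul, fun m hm => hE.hom_ext (hm.e₁_m.trans mul.e₁_m.symm)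
    (hm.e₂_m.trans mul.e₂_m.symm)⟩

lemma localProductsAreLocalCoproducts_iff [HasLocalProducts 𝒞]
    (hpush : HasPushoutsOfSplitMonos 𝒞) :
    LocalProductsAreLocalCoproducts 𝒞 ↔ HasUniqueKiteMul (M₀ 𝒞) := by
  refine ⟨fun h => h.hasUniqueKiteMul _, fun h A B C E f r g s p₁ e₁ p₂ e₂ H => ?_⟩
  have : HasPushout r s := hpush r s ⟨⟨⟨f, H.r_f⟩⟩⟩ ⟨⟨⟨g, H.s_g⟩⟩⟩
  exact h.isPushout H (IsPushout.of_hasPushout r s)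

end NaturallyMaltsev

/-! ### The Mal'tsev case -/

section Maltsev

variable {𝒞 : Type u} [Category.{v} 𝒞]

lemma localProductsAreExtremal_iff :
    LocalProductsAreExtremal 𝒞 ↔ HasUniqueKiteMul (M₁ 𝒞) := by
  constructor
  · intro h A B C E f r g s p₁ e₁ p₂ e₂ H S hS α γ hβ hα hγ
    obtain ⟨m, ⟨hmd, hmc, hm₁, hm₂⟩, unique⟩ := h _ _ _ _ ⟨_, _, _, _, _, H⟩ S hS α γ
      (by rw [reassoc_of% H.e₁_p₂, ← reassoc_of% hβ, ← hα])
      (by rw [reassoc_of% H.e₂_p₁, reassoc_of% hβ, ← hγ])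
    exact ⟨m, ⟨hm₁, hm₂, hmd, hmc⟩, fun n hn => unique n ⟨hn.m_d, hn.m_c, hn.e₁_m, hn.e₂_m⟩⟩
  · rintro h A C E p₁ e₁ p₂ e₂ ⟨B, f, r, g, s, H⟩ S hS α γ hα hγ
    rw [reassoc_of% H.e₁_p₂] at hα
    rw [reassoc_of% H.e₂_p₁] at hγ
    have hβ : r ≫ α = s ≫ γ := by
      apply hS
      · rw [Category.assoc, Category.assoc, hα, reassoc_of% H.r_f]
      · rw [Category.assoc, Category.assoc, hγ, reassoc_of% H.s_g]
    obtain ⟨m, hm, unique⟩ := h H S hS α γ hβ (by rw [reassoc_of% hβ, ← hα])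
      (by rw [← reassoc_of% hβ, ← hγ])
    exact ⟨m, ⟨hm.m_d, hm.m_c, hm.e₁_m, hm.e₂_m⟩,
      fun n ⟨hnd, hnc, hn₁, hn₂⟩ => unique n ⟨hn₁, hn₂, hnd, hnc⟩⟩

variable [HasLocalProducts 𝒞]

lemma Span.IsPregroupoid.natural_of_jointlyMonic {S T : Span 𝒞} {p : S.Kdc ⟶ S.D}
    {q : T.Kdc ⟶ T.D} (hp : S.IsPregroupoid p) (hq : T.IsPregroupoid q)
    (hT : JointlyMonic T.d T.c) (φ : S ⟶ T) : p ≫ φ.h = φ.cube ≫ q := by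
  apply hT
  · rw [Category.assoc, Category.assoc, hq.comp_d, φ.d_comm, reassoc_of% hp.comp_d,
      reassoc_of% cube_lst φ, φ.d_comm]
  · rw [Category.assoc, Category.assoc, hq.comp_c, φ.c_comm, reassoc_of% hp.comp_c,
      reassoc_of% cube_fst φ, φ.c_comm]

lemma Span.isPregroupoid_of_symmetry {S : Span 𝒞} (hS : JointlyMonic S.d S.c)
    {i : S.Kdc ⟶ S.Kdc} (i_lst : i ≫ S.lst = S.fst) (i_fst : i ≫ S.fst = S.lst) :
    S.IsPregroupoid (i ≫ S.mid) := by
  have hd : (i ≫ S.mid) ≫ S.d = S.lst ≫ S.d := by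
    rw [Category.assoc, ← S.fst_d, reassoc_of% i_fst]
  have hc : (i ≫ S.mid) ≫ S.c = S.fst ≫ S.c := by
    rw [Category.assoc, S.mid_c, reassoc_of% i_lst]
  refine .of_triple (fun Z x y h => hS _ _ ?_ ?_) (fun Z y z h => hS _ _ ?_ ?_) hd hc
  · rw [Category.assoc, hd, ← Category.assoc, triple_lst, h]
  · rw [Category.assoc, hc, ← Category.assoc, triple_fst]
  · rw [Category.assoc, hd, ← Category.assoc, triple_lst]
  · rw [Category.assoc, hc, ← Category.assoc, triple_fst, h]

lemma IsMaltsev.hasNaturalPregroupoids (h : IsMaltsev 𝒞) : HasNaturalPregroupoids (M₁ 𝒞) := by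
  choose i i_lst i_fst using fun (S : Span 𝒞) (hS : M₁ 𝒞 S) =>
    h S.graph (Span.jointlyMonic_graph hS)
  have hp (S : Span 𝒞) (hS : M₁ 𝒞 S) : S.IsPregroupoid (i S hS ≫ S.mid) :=
    Span.isPregroupoid_of_symmetry hS (i_lst S hS) (i_fst S hS)
  exact ⟨_, hp, fun S T hS hT => (hp S hS).natural_of_jointlyMonic (hp T hT) hT⟩

lemma isMaltsev_iff : IsMaltsev 𝒞 ↔ HasUniqueKiteMul (M₁ 𝒞) := by
  refine ⟨fun h => (hasUniqueKiteMul_iff_hasNaturalPregroupoids isAdequate_M₁).2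
    h.hasNaturalPregroupoids, fun h X hX => ?_⟩
  obtain ⟨U, rfl, -, i, hd, hc, -⟩ := h.exists_groupoid hX
  exact ⟨i, hd, hc⟩

end Maltsev

/-! ### The weakly Mal'tsev case -/

section WeaklyMaltsev

variable {𝒞 : Type u} [Category.{v} 𝒞]

lemma IsWeaklyMaltsev.hasUniqueKiteMul (h : IsWeaklyMaltsev 𝒞) : HasUniqueKiteMul (M₂ 𝒞) := by
  intro A B C E f r g s p₁ e₁ p₂ e₂ H S hS α γ hβ hα hγ
  obtain ⟨m, ⟨hm₁, hm₂, hmd, hmc⟩, unique⟩ := hS e₁ e₂ (h _ _ _ _ ⟨_, _, _, _, _, H⟩) α γ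
    (p₂ ≫ γ ≫ S.d) (p₁ ≫ α ≫ S.c)
    (by rw [reassoc_of% H.e₁_p₂, ← reassoc_of% hβ, ← hα]) (by rw [reassoc_of% H.e₁_p₁])
    (by rw [reassoc_of% H.e₂_p₂]) (by rw [reassoc_of% H.e₂_p₁, reassoc_of% hβ, ← hγ])
  exact ⟨m, ⟨hm₁, hm₂, hmd, hmc⟩, fun n hn => unique n ⟨hn.e₁_m, hn.e₂_m, hn.m_d, hn.m_c⟩⟩

lemma JointlyStronglyMonic.equalizer_ι_comp {D D₀ D₁ Z : 𝒞} {d : D ⟶ D₀} {c : D ⟶ D₁}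
    (h : JointlyStronglyMonic d c) (x y : D ⟶ Z) [HasEqualizer x y] :
    JointlyStronglyMonic (equalizer.ι x y ≫ d) (equalizer.ι x y ≫ c) := by
  apply jointlyStronglyMonic_of_exists
  intro X₁ X₂ Y e₁ e₂ he f₁ f₂ g₀ g₁ h₁ h₂ h₃ h₄
  simp only [← Category.assoc _ (equalizer.ι x y)] at h₁ h₂ h₃ h₄
  obtain ⟨m, ⟨hm₁, hm₂, hmd, hmc⟩, -⟩ := h e₁ e₂ he _ _ g₀ g₁ h₁ h₂ h₃ h₄
  have hm : m ≫ x = m ≫ y := by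
    apply he
    · rw [reassoc_of% hm₁, reassoc_of% hm₁, equalizer.condition]
    · rw [reassoc_of% hm₂, reassoc_of% hm₂, equalizer.condition]
  refine ⟨equalizer.lift m hm, ?_, ?_, by rwa [equalizer.lift_ι_assoc],
    by rwa [equalizer.lift_ι_assoc]⟩
  · apply equalizer.hom_ext
    rw [Category.assoc, equalizer.lift_ι, hm₁]
  · apply equalizer.hom_ext
    rw [Category.assoc, equalizer.lift_ι, hm₂]

lemma HasUniqueKiteMul.isWeaklyMaltsev [HasEqualizers 𝒞]
    (hker : HasKernelPairsOfEqualizerSplitEpi 𝒞) (h : HasUniqueKiteMul (M₂ 𝒞)) :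
    IsWeaklyMaltsev 𝒞 := by
  rintro A C E p₁ e₁ p₂ e₂ ⟨B, f, r, g, s, H⟩ Z x y h₁ h₂
  -- The multiplication of the kite on the equalizer of `x` and `y` is a section of its inclusion.
  let k := equalizer.ι x y
  let α : A ⟶ equalizer x y := equalizer.lift e₁ h₁
  let γ : C ⟶ equalizer x y := equalizer.lift e₂ h₂
  have α_k : α ≫ k = e₁ := equalizer.lift_ι _ _
  have γ_k : γ ≫ k = e₂ := equalizer.lift_ι _ _
  have := hker x y p₁ ⟨⟨⟨e₁, H.e₁_p₁⟩⟩⟩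
  have := hker x y p₂ ⟨⟨⟨e₂, H.e₂_p₂⟩⟩⟩
  have hS := (jointlyStronglyMonic_of_isPullback H.isPullback).swap.equalizer_ι_comp x y
  have hβ : r ≫ α = s ≫ γ :=
    equalizer.hom_ext (by rw [Category.assoc, Category.assoc, α_k, γ_k, H.r_e₁])
  let S : Span 𝒞 := { d := k ≫ p₂, c := k ≫ p₁ }
  obtain ⟨m, hm⟩ := (h H S hS α γ hβ
    (by simp only [S, reassoc_of% α_k, H.e₁_p₂, reassoc_of% H.r_f])
    (by simp only [S, reassoc_of% γ_k, H.e₂_p₁, reassoc_of% H.s_g])).exists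
  have mk : m ≫ k = 𝟙 E := by
    apply H.isPullback.hom_ext
    · simpa [S, reassoc_of% α_k, H.e₁_p₁] using hm.m_c
    · simpa [S, reassoc_of% γ_k, H.e₂_p₂] using hm.m_d
  calc x = m ≫ k ≫ x := by rw [reassoc_of% mk]
    _ = m ≫ k ≫ y := by rw [equalizer.condition]
    _ = y := by rw [reassoc_of% mk]

lemma isWeaklyMaltsev_iff [HasEqualizers 𝒞] (hker : HasKernelPairsOfEqualizerSplitEpi 𝒞) :
    IsWeaklyMaltsev 𝒞 ↔ HasUniqueKiteMul (M₂ 𝒞) :=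
  ⟨fun h => h.hasUniqueKiteMul, fun h => h.isWeaklyMaltsev hker⟩

end WeaklyMaltsev

end MaltsevType

end

theorem mainTheorem3 (𝒞 : Type u) [Category.{v} 𝒞] [MaltsevType.HasLocalProducts 𝒞] :
    -- (1) the naturally Mal'tsev case
    ((MaltsevType.IsNaturallyMaltsev 𝒞 ::
        MaltsevType.unificationConditions (MaltsevType.M₀ 𝒞)).TFAE ∧
      (∀ [HasBinaryProducts 𝒞] [HasTerminal 𝒞],
        (MaltsevType.IsNaturallyMaltsev 𝒞 ↔ MaltsevType.HasNaturalMaltsevOperation 𝒞)) ∧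
      (MaltsevType.HasPushoutsOfSplitMonos 𝒞 →
        (MaltsevType.IsNaturallyMaltsev 𝒞 ↔ MaltsevType.LocalProductsAreLocalCoproducts 𝒞))) ∧
    -- (2) the Mal'tsev case
    (MaltsevType.IsMaltsev 𝒞 :: MaltsevType.LocalProductsAreExtremal 𝒞 ::
        MaltsevType.unificationConditions (MaltsevType.M₁ 𝒞)).TFAE ∧
    -- (3) the weakly Mal'tsev case
    (∀ [HasEqualizers 𝒞], MaltsevType.HasKernelPairsOfEqualizerSplitEpi 𝒞 →
      (MaltsevType.IsWeaklyMaltsev 𝒞 ::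
        MaltsevType.unificationConditions (MaltsevType.M₂ 𝒞)).TFAE) := by
  open MaltsevType in
  refine ⟨⟨?_, ?_, fun hpush => ?_⟩, ?_, fun hker => ?_⟩
  · exact tfae_of_forall_iff (List.forall_mem_cons.2
      ⟨isNaturallyMaltsev_iff 𝒞, unificationConditions_iff isAdequate_M₀⟩)
  · intro _ _
    exact (isNaturallyMaltsev_iff 𝒞).trans hasNaturalMaltsevOperation_iff.symm
  · exact (isNaturallyMaltsev_iff 𝒞).trans (localProductsAreLocalCoproducts_iff hpush).symm
  · exact tfae_of_forall_iff (List.forall_mem_cons.2 ⟨isMaltsev_iff, List.forall_mem_cons.2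
      ⟨localProductsAreExtremal_iff, unificationConditions_iff isAdequate_M₁⟩⟩)
  · exact tfae_of_forall_iff (List.forall_mem_cons.2
      ⟨isWeaklyMaltsev_iff hker, unificationConditions_iff isAdequate_M₂⟩)
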